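/- Let $k$ be a field of characteristic $p\ge 3$. Let $A=k\langle y\mid y^p=0\rangle=k[y]/(y^p)$ be the $p$-dimensional Hopf algebra generated by a primitive element $y$, and let $H_4$ be Sweedler's Hopf algebra: it has basis $1,g,x,gx$ with $g^2=1$, $x^2=0$, $xg=-gx$, where $g$ is group-like and $\Delta(x)=x\otimes 1+g\otimes x$, $\varepsilon(x)=0$. Let $A_{4p}$ be the Hopf algebra generated as an algebra by $g$ and $x$ subject to $x^{2p}=0$, $g^2=1$, $xg=-gx$, where $g$ is group-like, $\Delta(x)=x\otimes 1+g\otimes x$ and $\varepsilon(x)=0$. For Hopf algebras $A,H$ over $k$, a crossed system is a pair $(\triangleright,f)$ consisting of a weak action $\triangleright:H\otimes A\to A$ (a linear map with $h\triangleright 1=\varepsilon(h)1$, $1\triangleright a=a$, $h\triangleright(ab)=(h_{(1)}\triangleright a)(h_{(2)}\triangleright b)$) and a linear map $f:H\otimes H\to A$ such that the vector space $A\otimes H$ is a Hopf algebra with multiplication $$(a\# h)(c\# g)=a\,(h_{(1)}\triangleright c)\,f(h_{(2)},g_{(1)})\,\#\,h_{(3)}g_{(2)},$$ unit $1\#1$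 and the tensor product coalgebra structure; this Hopf algebra is called a crossed product $A\# H$. Two crossed systems $(\triangleright,f)$, $(\triangleright',f')$ are cohomologous if there is a coalgebra map $r:H\to A$ with $r(1)=1$ and $r(h_{(1)})\otimes h_{(2)}=r(h_{(2)})\otimes h_{(1)}$ such that $h\triangleright' a=r(h_{(1)})(h_{(2)}\triangleright a)S_A(r(h_{(3)}))$ and $f'(h,g)=r(h_{(1)})(h_{(2)}\triangleright r(g_{(1)}))f(h_{(3)},g_{(2)})S_A(r(h_{(4)}g_{(3)}))$ for all $a\in A$, $h,g\in H$. Let $\mathcal H^2(H,A)$ be the set of crossed systems modulo this relation. Then: (1) Up to isomorphism of Hopf algebras there are exactly two crossed products $A\# H_4$, namely $A\otimes H_4$ and $A_{4p}$: every crossed product $A\# H_4$ is isomorphic to one of these, both occur, and they are not isomorphic to each other. Moreover $\dim_k A_{4p}=4p$, and there are group isomorphisms $\mathrm{Aut}_{\mathrm{Hopf}}(A\otimes H_4)\cong k^*\times k^*$ and $\mathrm{Aut}_{\mathrm{Hopf}}(A_{4p})\cong k^*$. (2) On the crossed systems for $(A,H_4)$, being cohomologous is an equivalence relation, and there is a bijection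 between $\mathcal H^2(H_4,A)$ and $k$. -/

import Mathlib

open scoped TensorProduct
open TensorProduct

noncomputable section

/-! ### Automorphism groups -/

/-- The group of Hopf algebra automorphisms of `E`, under composition.  (A bialgebra map between
Hopf algebras automatically commutes with the antipodes.) -/
instance HopfAut.instGroup {k E : Type*} [CommSemiring k] [Semiring E] [Bialgebra k E] :
    Group (E ≃ₐc[k] E) where
  mul φ ψ := ψ.trans φ
  one := BialgEquiv.refl k E
  inv φ := φ.symm
  mul_assoc _ _ _ := rfl
  one_mul _ := rfl
  mul_one _ := rfl
  inv_mul_cancel φ := BialgEquiv.ext fun x => φ.symm_apply_apply x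

/-! ### Crossed products of Hopf algebras -/

section Crossed

variable {k A H : Type*} [Field k] [Ring A] [Ring H] [HopfAlgebra k A] [HopfAlgebra k H]

/-- `▷ : H ⊗ A → A` is a weak action:
`h ▷ 1 = ε(h) 1`, `1 ▷ a = a`, `h ▷ (a b) = (h₁ ▷ a) (h₂ ▷ b)`. -/
structure IsWeakAction (act : H →ₗ[k] A →ₗ[k] A) : Prop where
  act_one : ∀ h : H, act h 1 = Coalgebra.counit (R := k) h • (1 : A)
  one_act : ∀ a : A, act 1 a = a
  act_mul : ∀ (h : H) (a b : A), act h (a * b) =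
    LinearMap.mul' k A (TensorProduct.map (act.flip a) (act.flip b) (Coalgebra.comul (R := k) h))

/-- The left multiplication `A ⊗ (A ⊗ H) → A ⊗ H`, `b ⊗ (a ⊗ h) ↦ b a ⊗ h`. -/
def crossedLeftMul (k A H : Type*) [Field k] [Ring A] [Ring H] [HopfAlgebra k A]
    [HopfAlgebra k H] : A ⊗[k] (A ⊗[k] H) →ₗ[k] A ⊗[k] H :=
  (LinearMap.mul' k A).rTensor H ∘ₗ (TensorProduct.assoc k A A H).symm.toLinearMap

/-- The map `H ⊗ H → A ⊗ H`, `h ⊗ g ↦ f(h₁, g₁) ⊗ h₂ g₂`. -/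
def crossedCocycleMul (f : H ⊗[k] H →ₗ[k] A) : H ⊗[k] H →ₗ[k] A ⊗[k] H :=
  TensorProduct.map f (LinearMap.mul' k H) ∘ₗ Coalgebra.comul (R := k) (A := H ⊗[k] H)

/-- The multiplication of the crossed product on the vector space `A ⊗ H`:
`(a # h) (c # g) = a (h₁ ▷ c) f(h₂, g₁) # h₃ g₂`.  The composite is
`(a ⊗ h) ⊗ (c ⊗ g) ↦ a ⊗ (h ⊗ (c ⊗ g)) ↦ a ⊗ ((h₁ ⊗ h₂) ⊗ (c ⊗ g)) ↦
a ⊗ ((h₁ ⊗ c) ⊗ (h₂ ⊗ g)) ↦ a ⊗ ((h₁ ▷ c) ⊗ (f(h₂, g₁) ⊗ h₃ g₂))`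
followed by multiplication in `A`. -/
def crossedMul (act : H →ₗ[k] A →ₗ[k] A) (f : H ⊗[k] H →ₗ[k] A) :
    (A ⊗[k] H) ⊗[k] (A ⊗[k] H) →ₗ[k] A ⊗[k] H :=
  crossedLeftMul k A H ∘ₗ
    (crossedLeftMul k A H ∘ₗ
      TensorProduct.map (TensorProduct.lift act) (crossedCocycleMul f) ∘ₗ
      (TensorProduct.tensorTensorTensorComm k H H A H).toLinearMap ∘ₗ
      (Coalgebra.comul (R := k) (A := H)).rTensor (A ⊗[k] H)).lTensor A ∘ₗ
    (TensorProduct.assoc k A H (A ⊗[k] H)).toLinearMap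

/-- The defining formula of the multiplication, with Sweedler sums written out. -/
theorem crossedMul_tmul (act : H →ₗ[k] A →ₗ[k] A) (f : H ⊗[k] H →ₗ[k] A) (a c : A) (h g : H)
    {ι κ : Type*} {μ : ι → Type*} (rh : Coalgebra.Repr k h ι)
    (rr : ∀ i, Coalgebra.Repr k (rh.right i) (μ i)) (rg : Coalgebra.Repr k g κ) :
    crossedMul act f ((a ⊗ₜ[k] h) ⊗ₜ[k] (c ⊗ₜ[k] g)) =
      ∑ i ∈ rh.index, ∑ j ∈ (rr i).index, ∑ l ∈ rg.index,
        (a * act (rh.left i) c * f ((rr i).left j ⊗ₜ[k] rg.left l)) ⊗ₜ[k]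
          ((rr i).right j * rg.right l) := by
  simp only [crossedMul, crossedCocycleMul, crossedLeftMul, LinearMap.comp_apply,
    LinearEquiv.coe_coe, TensorProduct.assoc_tmul, LinearMap.lTensor_tmul,
    LinearMap.rTensor_tmul, ← rh.eq, TensorProduct.sum_tmul, map_sum,
    TensorProduct.tensorTensorTensorComm_tmul, TensorProduct.map_tmul, TensorProduct.comul_tmul,
    TensorProduct.tmul_sum]
  refine Finset.sum_congr rfl fun i _ => ?_
  rw [← (rr i).eq, ← rg.eq]
  simp only [TensorProduct.sum_tmul, TensorProduct.tmul_sum, map_sum,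
    TensorProduct.AlgebraTensorModule.tensorTensorTensorComm_tmul, TensorProduct.map_tmul,
    LinearMap.mul'_apply, TensorProduct.lift.tmul, TensorProduct.assoc_symm_tmul,
    LinearMap.rTensor_tmul, mul_assoc]
  exact Finset.sum_comm

/-- `(A, H, ▷, f)` is a crossed system of Hopf algebras: `▷` is a weak action and the vector space
`A ⊗ H`, with the multiplication `crossedMul`, the unit `1 # 1` and the tensor product coalgebra
structure, is a Hopf algebra. -/
structure IsCrossedSystem (act : H →ₗ[k] A →ₗ[k] A) (f : H ⊗[k] H →ₗ[k] A) : Prop where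
  weakAction : IsWeakAction act
  mul_assoc : ∀ x y z : A ⊗[k] H,
    crossedMul act f (crossedMul act f (x ⊗ₜ[k] y) ⊗ₜ[k] z) =
      crossedMul act f (x ⊗ₜ[k] crossedMul act f (y ⊗ₜ[k] z))
  one_mul : ∀ x : A ⊗[k] H, crossedMul act f (((1 : A) ⊗ₜ[k] (1 : H)) ⊗ₜ[k] x) = x
  mul_one : ∀ x : A ⊗[k] H, crossedMul act f (x ⊗ₜ[k] ((1 : A) ⊗ₜ[k] (1 : H))) = x
  counit_mul : ∀ x y : A ⊗[k] H,
    Coalgebra.counit (R := k) (crossedMul act f (x ⊗ₜ[k] y)) =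
      Coalgebra.counit (R := k) x * Coalgebra.counit (R := k) y
  comul_mul : ∀ x y : A ⊗[k] H,
    Coalgebra.comul (R := k) (crossedMul act f (x ⊗ₜ[k] y)) =
      TensorProduct.map (crossedMul act f) (crossedMul act f)
        (TensorProduct.tensorTensorTensorComm k (A ⊗[k] H) (A ⊗[k] H) (A ⊗[k] H) (A ⊗[k] H)
          (Coalgebra.comul (R := k) x ⊗ₜ[k] Coalgebra.comul (R := k) y))
  exists_antipode : ∃ S : A ⊗[k] H →ₗ[k] A ⊗[k] H, ∀ x : A ⊗[k] H,
    crossedMul act f (S.rTensor (A ⊗[k] H) (Coalgebra.comul (R := k) x)) =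
        Coalgebra.counit (R := k) x • ((1 : A) ⊗ₜ[k] (1 : H)) ∧
      crossedMul act f (S.lTensor (A ⊗[k] H) (Coalgebra.comul (R := k) x)) =
        Coalgebra.counit (R := k) x • ((1 : A) ⊗ₜ[k] (1 : H))

end Crossed

/-- The set `CS(A, H)` of all pairs `(▷, f)` such that `(A, H, ▷, f)` is a crossed system of Hopf
algebras. -/
@[ext]
structure CrossedSystem (k A H : Type*) [Field k] [Ring A] [Ring H] [HopfAlgebra k A]
    [HopfAlgebra k H] where
  act : H →ₗ[k] A →ₗ[k] A
  coc : H ⊗[k] H →ₗ[k] A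
  isCrossedSystem : IsCrossedSystem act coc

/-- The underlying vector space `A ⊗ H` of the crossed product `A # H` of a crossed system. -/
def CrossedProduct {k A H : Type*} [Field k] [Ring A] [Ring H] [HopfAlgebra k A]
    [HopfAlgebra k H] (_ : CrossedSystem k A H) : Type _ :=
  A ⊗[k] H

namespace CrossedProduct

variable {k A H : Type*} [Field k] [Ring A] [Ring H] [HopfAlgebra k A] [HopfAlgebra k H]
  (S : CrossedSystem k A H)

instance instAddCommGroup : AddCommGroup (CrossedProduct S) :=
  inferInstanceAs (AddCommGroup (A ⊗[k] H))

instance instModule : Module k (CrossedProduct S) :=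
  inferInstanceAs (Module k (A ⊗[k] H))

instance instCoalgebra : Coalgebra k (CrossedProduct S) :=
  inferInstanceAs (Coalgebra k (A ⊗[k] H))

/-- The multiplication of `A # H` as a linear map. -/
def mulMap : CrossedProduct S ⊗[k] CrossedProduct S →ₗ[k] CrossedProduct S :=
  crossedMul S.act S.coc

instance instRing : Ring (CrossedProduct S) :=
  { instAddCommGroup S with
    mul := fun x y => mulMap S (x ⊗ₜ[k] y)
    one := (1 : A) ⊗ₜ[k] (1 : H)
    left_distrib := fun x y z => by
      change mulMap S (x ⊗ₜ[k] (y + z)) = mulMap S (x ⊗ₜ[k] y) + mulMap S (x ⊗ₜ[k] z)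
      rw [TensorProduct.tmul_add, map_add]
    right_distrib := fun x y z => by
      change mulMap S ((x + y) ⊗ₜ[k] z) = mulMap S (x ⊗ₜ[k] z) + mulMap S (y ⊗ₜ[k] z)
      rw [TensorProduct.add_tmul, map_add]
    zero_mul := fun x => by
      change mulMap S ((0 : CrossedProduct S) ⊗ₜ[k] x) = 0
      rw [TensorProduct.zero_tmul, map_zero]
    mul_zero := fun x => by
      change mulMap S (x ⊗ₜ[k] (0 : CrossedProduct S)) = 0
      rw [TensorProduct.tmul_zero, map_zero]
    mul_assoc := S.isCrossedSystem.mul_assoc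
    one_mul := S.isCrossedSystem.one_mul
    mul_one := S.isCrossedSystem.mul_one
    zsmul := (instAddCommGroup S).zsmul
    zsmul_zero' := (instAddCommGroup S).zsmul_zero'
    zsmul_succ' := (instAddCommGroup S).zsmul_succ'
    zsmul_neg' := (instAddCommGroup S).zsmul_neg'
    neg_add_cancel := (instAddCommGroup S).neg_add_cancel
    sub_eq_add_neg := (instAddCommGroup S).sub_eq_add_neg }

theorem mul_def (x y : CrossedProduct S) : x * y = mulMap S (x ⊗ₜ[k] y) := rfl

instance instAlgebra : Algebra k (CrossedProduct S) :=
  Algebra.ofModule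
    (fun r x y => by
      rw [mul_def, mul_def, ← TensorProduct.smul_tmul', map_smul])
    (fun r x y => by
      rw [mul_def, mul_def, TensorProduct.tmul_smul, map_smul])

theorem mul'_eq : LinearMap.mul' k (CrossedProduct S) = mulMap S :=
  TensorProduct.ext' fun _ _ => rfl

theorem map_mul_comm (u v : CrossedProduct S ⊗[k] CrossedProduct S) :
    TensorProduct.map (mulMap S) (mulMap S)
      (TensorProduct.tensorTensorTensorComm k _ _ _ _ (u ⊗ₜ[k] v)) = u * v := by
  induction u with
  | zero => simp
  | add a b ha hb => rw [TensorProduct.add_tmul, map_add, map_add, ha, hb, add_mul]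
  | tmul a b =>
    induction v with
    | zero => simp
    | add c d hc hd => rw [TensorProduct.tmul_add, map_add, map_add, hc, hd, mul_add]
    | tmul c d =>
      rw [TensorProduct.tensorTensorTensorComm_tmul, TensorProduct.map_tmul,
        Algebra.TensorProduct.tmul_mul_tmul, mul_def, mul_def]

instance instBialgebra : Bialgebra k (CrossedProduct S) :=
  Bialgebra.mk' k (CrossedProduct S)
    (by
      change Coalgebra.counit (R := k) ((1 : A) ⊗ₜ[k] (1 : H)) = 1
      simp)
    (fun {a b} => S.isCrossedSystem.counit_mul a b)
    (by
      change Coalgebra.comul (R := k) ((1 : A) ⊗ₜ[k] (1 : H)) =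
        ((1 : A) ⊗ₜ[k] (1 : H)) ⊗ₜ[k] ((1 : A) ⊗ₜ[k] (1 : H))
      simp [Algebra.TensorProduct.one_def])
    (fun {a b} => (S.isCrossedSystem.comul_mul a b).trans (map_mul_comm S _ _))

/-- The crossed product `A # H` as a Hopf algebra. -/
instance instHopfAlgebra : HopfAlgebra k (CrossedProduct S) where
  antipode := S.isCrossedSystem.exists_antipode.choose
  mul_antipode_rTensor_comul := by
    rw [mul'_eq]
    refine LinearMap.ext fun x => ?_
    refine (S.isCrossedSystem.exists_antipode.choose_spec x).1.trans ?_
    exact (Algebra.algebraMap_eq_smul_one (R := k) (A := CrossedProduct S) _).symm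
  mul_antipode_lTensor_comul := by
    rw [mul'_eq]
    refine LinearMap.ext fun x => ?_
    refine (S.isCrossedSystem.exists_antipode.choose_spec x).2.trans ?_
    exact (Algebra.algebraMap_eq_smul_one (R := k) (A := CrossedProduct S) _).symm

end CrossedProduct

/-! ### The cohomological object `H²(H, A)` -/

/-- Convolution of linear maps from a coalgebra to an algebra: `c ↦ φ(c₁) ψ(c₂)`. -/
def convMul {k C A : Type*} [Field k] [AddCommGroup C] [Module k C] [Coalgebra k C] [Ring A]
    [Algebra k A] (φ ψ : C →ₗ[k] A) : C →ₗ[k] A :=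
  LinearMap.mul' k A ∘ₗ TensorProduct.map φ ψ ∘ₗ Coalgebra.comul (R := k) (A := C)

section Cohomology

variable {k A H : Type*} [Field k] [Ring A] [Ring H] [HopfAlgebra k A] [HopfAlgebra k H]

/-- A coalgebra map `r : H → A` is cocentral: `r(h₁) ⊗ h₂ = r(h₂) ⊗ h₁`. -/
def IsCocentral (r : H →ₗc[k] A) : Prop :=
  ∀ h : H, (r : H →ₗ[k] A).rTensor H (Coalgebra.comul (R := k) h) =
    (r : H →ₗ[k] A).rTensor H (TensorProduct.comm k H H (Coalgebra.comul (R := k) h))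

/-- Two crossed systems `(▷, f)` and `(▷', f')` are cohomologous: for some unitary cocentral map
`r : H → A`, writing `S` for the antipode of `A`,
`h ▷' a = r(h₁) (h₂ ▷ a) S(r(h₃))` and
`f'(h, g) = r(h₁) (h₂ ▷ r(g₁)) f(h₃, g₂) S(r(h₄ g₃))`.
The second right-hand side is the convolution, on the coalgebra `H ⊗ H`, of the four maps
`h ⊗ g ↦ r(h) ε(g)`, `h ⊗ g ↦ h ▷ r(g)`, `f` and `h ⊗ g ↦ S(r(h g))`. -/
def Cohomologous (X Y : CrossedSystem k A H) : Prop :=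
  ∃ r : H →ₗc[k] A, r 1 = 1 ∧ IsCocentral r ∧
    (∀ (h : H) (a : A), Y.act h a =
      convMul (r : H →ₗ[k] A)
        (convMul (X.act.flip a) (HopfAlgebra.antipode k ∘ₗ (r : H →ₗ[k] A))) h) ∧
    Y.coc =
      convMul
        ((TensorProduct.rid k A).toLinearMap ∘ₗ
          TensorProduct.map (r : H →ₗ[k] A) (Coalgebra.counit (R := k) (A := H)))
        (convMul
          (TensorProduct.lift X.act ∘ₗ (r : H →ₗ[k] A).lTensor H)
          (convMul X.coc
            (HopfAlgebra.antipode k ∘ₗ (r : H →ₗ[k] A) ∘ₗ LinearMap.mul' k H)))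

end Cohomology

/-- The cohomological object `H²(H, A)`: the quotient of the set of crossed systems by the relation
of being cohomologous. -/
def CrossedH2 (k H A : Type*) [Field k] [Ring A] [Ring H] [HopfAlgebra k A] [HopfAlgebra k H] :
    Type _ :=
  Quot (Cohomologous (k := k) (A := A) (H := H))

/-! ### Antipodes of bialgebras given by generators -/

section OfGenerators

variable {k B : Type*} [Field k] [Ring B] [Bialgebra k B]

/-- An anti-homomorphism of algebras, as a linear map. -/
def antiLinear (S : B →ₐ[k] Bᵐᵒᵖ) : B →ₗ[k] B :=
  (MulOpposite.opLinearEquiv k).symm.toLinearMap ∘ₗ S.toLinearMap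

@[simp]
theorem antiLinear_apply (S : B →ₐ[k] Bᵐᵒᵖ) (b : B) : antiLinear S b = (S b).unop := rfl

theorem antiLinear_left (S : B →ₐ[k] Bᵐᵒᵖ) (s : Set B) (hs : Algebra.adjoin k s = ⊤)
    (h : ∀ b ∈ s, LinearMap.mul' k B ((antiLinear S).rTensor B (Coalgebra.comul (R := k) b)) =
      algebraMap k B (Coalgebra.counit (R := k) b)) (b : B) :
    LinearMap.mul' k B ((antiLinear S).rTensor B (Coalgebra.comul (R := k) b)) =
      algebraMap k B (Coalgebra.counit (R := k) b) := by
  have hb : b ∈ Algebra.adjoin k s := hs ▸ Algebra.mem_top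
  induction hb using Algebra.adjoin_induction with
  | mem x hx => exact h x hx
  | algebraMap r => simp [Algebra.algebraMap_eq_smul_one, Algebra.TensorProduct.one_def]
  | add x y _ _ hx hy => simp [hx, hy]
  | mul x y _ _ hx hy =>
    have key : ∀ u v : B ⊗[k] B, ∀ r : k,
        LinearMap.mul' k B ((antiLinear S).rTensor B u) = algebraMap k B r →
        LinearMap.mul' k B ((antiLinear S).rTensor B (u * v)) =
          r • LinearMap.mul' k B ((antiLinear S).rTensor B v) := by
      intro u v r hu
      induction v with
      | zero => simp
      | add c d hc hd => simp only [mul_add, map_add, hc, hd, smul_add]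
      | tmul c d =>
        have h2 : LinearMap.mul' k B ((antiLinear S).rTensor B (u * (c ⊗ₜ[k] d))) =
            antiLinear S c * LinearMap.mul' k B ((antiLinear S).rTensor B u) * d := by
          clear hu
          induction u with
          | zero => simp
          | add u v hu hv => simp only [add_mul, mul_add, map_add, hu, hv]
          | tmul e f => simp [mul_assoc]
        rw [h2, hu, Algebra.algebraMap_eq_smul_one]
        simp
    rw [Bialgebra.comul_mul, key _ _ _ hx, hy, Bialgebra.counit_mul, map_mul, Algebra.smul_def]

theorem antiLinear_right (S : B →ₐ[k] Bᵐᵒᵖ) (s : Set B) (hs : Algebra.adjoin k s = ⊤)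
    (h : ∀ b ∈ s, LinearMap.mul' k B ((antiLinear S).lTensor B (Coalgebra.comul (R := k) b)) =
      algebraMap k B (Coalgebra.counit (R := k) b)) (b : B) :
    LinearMap.mul' k B ((antiLinear S).lTensor B (Coalgebra.comul (R := k) b)) =
      algebraMap k B (Coalgebra.counit (R := k) b) := by
  have hb : b ∈ Algebra.adjoin k s := hs ▸ Algebra.mem_top
  induction hb using Algebra.adjoin_induction with
  | mem x hx => exact h x hx
  | algebraMap r => simp [Algebra.algebraMap_eq_smul_one, Algebra.TensorProduct.one_def]
  | add x y _ _ hx hy => simp [hx, hy]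
  | mul x y _ _ hx hy =>
    have key : ∀ u v : B ⊗[k] B, ∀ r : k,
        LinearMap.mul' k B ((antiLinear S).lTensor B v) = algebraMap k B r →
        LinearMap.mul' k B ((antiLinear S).lTensor B (u * v)) =
          r • LinearMap.mul' k B ((antiLinear S).lTensor B u) := by
      intro u v r hv
      induction u with
      | zero => simp
      | add c d hc hd => simp only [add_mul, map_add, hc, hd, smul_add]
      | tmul c d =>
        have h2 : LinearMap.mul' k B ((antiLinear S).lTensor B ((c ⊗ₜ[k] d) * v)) =
            c * LinearMap.mul' k B ((antiLinear S).lTensor B v) * antiLinear S d := by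
          clear hv
          induction v with
          | zero => simp
          | add u v hu hv => simp only [add_mul, mul_add, map_add, hu, hv]
          | tmul e f => simp [mul_assoc]
        rw [h2, hv, Algebra.algebraMap_eq_smul_one]
        simp
    rw [Bialgebra.comul_mul, key _ _ _ hy, hx, Bialgebra.counit_mul, map_mul, Algebra.smul_def,
      ← Algebra.commutes]

/-- A bialgebra with an algebra anti-endomorphism that satisfies the antipode identities on a set
of generators is a Hopf algebra. -/
abbrev HopfAlgebra.ofGenerators (S : B →ₐ[k] Bᵐᵒᵖ) (s : Set B) (hs : Algebra.adjoin k s = ⊤)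
    (hl : ∀ b ∈ s, LinearMap.mul' k B ((antiLinear S).rTensor B (Coalgebra.comul (R := k) b)) =
      algebraMap k B (Coalgebra.counit (R := k) b))
    (hr : ∀ b ∈ s, LinearMap.mul' k B ((antiLinear S).lTensor B (Coalgebra.comul (R := k) b)) =
      algebraMap k B (Coalgebra.counit (R := k) b)) : HopfAlgebra k B where
  antipode := antiLinear S
  mul_antipode_rTensor_comul := LinearMap.ext (antiLinear_left S s hs hl)
  mul_antipode_lTensor_comul := LinearMap.ext (antiLinear_right S s hs hr)

end OfGenerators

/-! ### Sweedler's four-dimensional Hopf algebra -/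

/-- Sweedler's algebra `H₄`: the `k`-algebra with basis `1, g, x, gx` and
`g² = 1`, `x² = 0`, `x g = - g x`.  This is the generalized quaternion algebra with parameters
`i² = 1`, `j² = 0`, in which `g = i`, `x = j`, `g x = i j`. -/
def Sweedler (k : Type*) [Field k] : Type _ := QuaternionAlgebra k 1 0 0

namespace Sweedler

variable (k : Type*) [Field k]

instance instRing : Ring (Sweedler k) := inferInstanceAs (Ring (QuaternionAlgebra k 1 0 0))

instance instAlgebra : Algebra k (Sweedler k) :=
  inferInstanceAs (Algebra k (QuaternionAlgebra k 1 0 0))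

/-- The generator `g`. -/
def g : Sweedler k := (⟨0, 1, 0, 0⟩ : QuaternionAlgebra k 1 0 0)

/-- The generator `x`. -/
def x : Sweedler k := (⟨0, 0, 1, 0⟩ : QuaternionAlgebra k 1 0 0)

/-- The basis `1, g, x, gx`. -/
def basis : Module.Basis (Fin 4) k (Sweedler k) := QuaternionAlgebra.basisOneIJK (1 : k) 0 0

theorem basis_eq : ⇑(basis k) = ![1, g k, x k, g k * x k] := by
  have h (i : Fin 4) (q : QuaternionAlgebra k 1 0 0)
      (hq : ![q.re, q.imI, q.imJ, q.imK] = Pi.single i 1) : basis k i = q := by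
    refine (basis k).repr.injective (DFunLike.coe_injective ?_)
    rw [Module.Basis.repr_self, Finsupp.single_eq_pi_single, ← hq]
    exact (QuaternionAlgebra.coe_basisOneIJK_repr (1 : k) 0 0 q).symm
  funext i
  fin_cases i
  · exact h 0 1 (by funext j; fin_cases j <;> simp)
  · exact h 1 ⟨0, 1, 0, 0⟩ (by funext j; fin_cases j <;> simp)
  · exact h 2 ⟨0, 0, 1, 0⟩ (by funext j; fin_cases j <;> simp)
  · exact h 3 ((⟨0, 1, 0, 0⟩ : QuaternionAlgebra k 1 0 0) * ⟨0, 0, 1, 0⟩)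
      (by funext j; fin_cases j <;> simp)

theorem g_mul_g : g k * g k = 1 := by
  change (⟨0, 1, 0, 0⟩ : QuaternionAlgebra k 1 0 0) * ⟨0, 1, 0, 0⟩ = 1
  ext <;> simp

theorem x_mul_x : x k * x k = 0 := by
  change (⟨0, 0, 1, 0⟩ : QuaternionAlgebra k 1 0 0) * ⟨0, 0, 1, 0⟩ = 0
  ext <;> simp

theorem x_mul_g : x k * g k = -(g k * x k) := by
  change (⟨0, 0, 1, 0⟩ : QuaternionAlgebra k 1 0 0) * ⟨0, 1, 0, 0⟩ =
    -((⟨0, 1, 0, 0⟩ : QuaternionAlgebra k 1 0 0) * ⟨0, 0, 1, 0⟩)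
  ext <;> simp

variable {k}

/-- The algebra map out of `H₄` given by the images of `g` and `x`. -/
def lift {B : Type*} [Ring B] [Algebra k B] (G X : B) (hG : G * G = 1) (hX : X * X = 0)
    (hXG : X * G = -(G * X)) : Sweedler k →ₐ[k] B :=
  QuaternionAlgebra.lift (R := k) (c₁ := 1) (c₂ := 0) (c₃ := 0)
    { i := G, j := X, k := G * X
      i_mul_i := by simp [hG]
      j_mul_j := by simp [hX]
      i_mul_j := rfl
      j_mul_i := by simp [hXG] }

@[simp]
theorem lift_g {B : Type*} [Ring B] [Algebra k B] (G X : B) (hG hX hXG) :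
    lift (k := k) G X hG hX hXG (g k) = G := by
  change QuaternionAlgebra.Basis.lift _ (⟨0, 1, 0, 0⟩ : QuaternionAlgebra k 1 0 0) = G
  simp [QuaternionAlgebra.Basis.lift]

@[simp]
theorem lift_x {B : Type*} [Ring B] [Algebra k B] (G X : B) (hG hX hXG) :
    lift (k := k) G X hG hX hXG (x k) = X := by
  change QuaternionAlgebra.Basis.lift _ (⟨0, 0, 1, 0⟩ : QuaternionAlgebra k 1 0 0) = X
  simp [QuaternionAlgebra.Basis.lift]

theorem algHom_ext {B : Type*} [Ring B] [Algebra k B] {φ ψ : Sweedler k →ₐ[k] B}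
    (hg : φ (g k) = ψ (g k)) (hx : φ (x k) = ψ (x k)) : φ = ψ :=
  QuaternionAlgebra.hom_ext (R := k) (c₁ := 1) (c₂ := 0) (c₃ := 0) hg hx

variable (k)

theorem adjoin_eq_top : Algebra.adjoin k {g k, x k} = ⊤ := by
  rw [eq_top_iff]
  intro b _
  let T := Algebra.adjoin k {g k, x k}
  let φ : Sweedler k →ₐ[k] T := lift ⟨g k, Algebra.subset_adjoin (by simp)⟩
    ⟨x k, Algebra.subset_adjoin (by simp)⟩ (Subtype.ext (g_mul_g k)) (Subtype.ext (x_mul_x k))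
    (Subtype.ext (x_mul_g k))
  have h : T.val.comp φ = AlgHom.id k _ := algHom_ext (by simp [φ]) (by simp [φ])
  have hb : T.val (φ b) = b := DFunLike.congr_fun h b
  exact hb ▸ (φ b).2

/-- The comultiplication: `Δ(g) = g ⊗ g`, `Δ(x) = x ⊗ 1 + g ⊗ x`. -/
def comulHom : Sweedler k →ₐ[k] Sweedler k ⊗[k] Sweedler k :=
  lift (g k ⊗ₜ[k] g k) (x k ⊗ₜ[k] 1 + g k ⊗ₜ[k] x k)
    (by simp [g_mul_g, Algebra.TensorProduct.one_def])
    (by simp [mul_add, add_mul, x_mul_x, x_mul_g, TensorProduct.neg_tmul])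
    (by simp [mul_add, add_mul, x_mul_g, g_mul_g, TensorProduct.neg_tmul, TensorProduct.tmul_neg,
      add_comm])

/-- The counit: `ε(g) = 1`, `ε(x) = 0`. -/
def counitHom : Sweedler k →ₐ[k] k := lift 1 0 (by simp) (by simp) (by simp)

instance instBialgebra : Bialgebra k (Sweedler k) :=
  Bialgebra.ofAlgHom (comulHom k) (counitHom k)
    (algHom_ext (by simp [comulHom])
      (by simp [comulHom, TensorProduct.add_tmul, TensorProduct.tmul_add,
        Algebra.TensorProduct.one_def, add_assoc]))
    (algHom_ext (by simp [comulHom, counitHom]) (by simp [comulHom, counitHom]))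
    (algHom_ext (by simp [comulHom, counitHom]) (by simp [comulHom, counitHom]))

@[simp]
theorem comul_g : Coalgebra.comul (R := k) (g k) = g k ⊗ₜ[k] g k := by
  change comulHom k (g k) = _
  simp [comulHom]

@[simp]
theorem comul_x : Coalgebra.comul (R := k) (x k) = x k ⊗ₜ[k] 1 + g k ⊗ₜ[k] x k := by
  change comulHom k (x k) = _
  simp [comulHom]

@[simp]
theorem counit_g : Coalgebra.counit (R := k) (g k) = 1 := by
  change counitHom k (g k) = _
  simp [counitHom]

@[simp]
theorem counit_x : Coalgebra.counit (R := k) (x k) = 0 := by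
  change counitHom k (x k) = _
  simp [counitHom]

/-- The antipode: `S(g) = g`, `S(x) = - g x`, extended as an anti-homomorphism. -/
def antipodeHom : Sweedler k →ₐ[k] (Sweedler k)ᵐᵒᵖ :=
  lift (.op (g k)) (.op (-(g k * x k)))
    (by rw [← MulOpposite.op_mul, g_mul_g, MulOpposite.op_one])
    (by
      rw [← MulOpposite.op_mul, neg_mul_neg, mul_assoc, ← mul_assoc (x k), x_mul_g, neg_mul,
        mul_assoc (g k) (x k), x_mul_x]
      simp)
    (by
      rw [← MulOpposite.op_mul, ← MulOpposite.op_mul, ← MulOpposite.op_neg, mul_neg, neg_mul,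
        neg_neg, mul_assoc, x_mul_g, mul_neg])

instance instHopfAlgebra : HopfAlgebra k (Sweedler k) :=
  HopfAlgebra.ofGenerators (antipodeHom k) {g k, x k} (adjoin_eq_top k)
    (by
      rintro b (rfl | rfl)
      · simp [antipodeHom, g_mul_g]
      · simp [antipodeHom])
    (by
      rintro b (rfl | rfl)
      · simp [antipodeHom, g_mul_g]
      · simp [antipodeHom, ← mul_assoc, g_mul_g])

end Sweedler

theorem add_pow_of_commute_of_charP (k : Type*) [Field k] (p : ℕ) [Fact p.Prime] [CharP k p]
    {B : Type*} [Ring B] [Algebra k B] {a b : B} (h : Commute a b) :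
    (a + b) ^ p = a ^ p + b ^ p := by
  cases subsingleton_or_nontrivial B
  · exact Subsingleton.elim _ _
  · have : CharP B p := charP_of_injective_algebraMap (algebraMap k B).injective p
    exact add_pow_char_of_commute p h

/-! ### The Hopf algebra `k⟨y | y ^ p = 0⟩` -/

/-- The algebra `k⟨y | y ^ p = 0⟩ = k[Y] / (Y ^ p)`. -/
def TruncPoly (k : Type*) [Field k] (p : ℕ) : Type _ :=
  AdjoinRoot ((Polynomial.X : Polynomial k) ^ p)

namespace TruncPoly

variable (k : Type*) [Field k] (p : ℕ)

instance instCommRing : CommRing (TruncPoly k p) :=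
  inferInstanceAs (CommRing (AdjoinRoot ((Polynomial.X : Polynomial k) ^ p)))

instance instAlgebra : Algebra k (TruncPoly k p) :=
  inferInstanceAs (Algebra k (AdjoinRoot ((Polynomial.X : Polynomial k) ^ p)))

/-- The generator `y`. -/
def y : TruncPoly k p := AdjoinRoot.root ((Polynomial.X : Polynomial k) ^ p)

theorem y_pow : y k p ^ p = 0 := by
  have h := AdjoinRoot.eval₂_root ((Polynomial.X : Polynomial k) ^ p)
  simpa using! h

variable {k p}

/-- The algebra map out of `k⟨y | y ^ p = 0⟩` given by the image of `y`. -/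
def lift {B : Type*} [CommRing B] [Algebra k B] (b : B) (hb : b ^ p = 0) :
    TruncPoly k p →ₐ[k] B :=
  AdjoinRoot.liftAlgHom ((Polynomial.X : Polynomial k) ^ p) (Algebra.ofId k B) b (by simp [hb])

@[simp]
theorem lift_y {B : Type*} [CommRing B] [Algebra k B] (b : B) (hb : b ^ p = 0) :
    lift (k := k) b hb (y k p) = b :=
  AdjoinRoot.liftAlgHom_root _ _ _ _

theorem algHom_ext {B : Type*} [CommRing B] [Algebra k B] {φ ψ : TruncPoly k p →ₐ[k] B}
    (h : φ (y k p) = ψ (y k p)) : φ = ψ :=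
  AdjoinRoot.algHom_ext (f := (Polynomial.X : Polynomial k) ^ p) h

variable (k p)

theorem adjoin_eq_top : Algebra.adjoin k {y k p} = ⊤ := by
  rw [eq_top_iff]
  intro b _
  let T := Algebra.adjoin k {y k p}
  let φ : TruncPoly k p →ₐ[k] T :=
    lift ⟨y k p, Algebra.subset_adjoin (by simp)⟩ (Subtype.ext (y_pow k p))
  have h : T.val.comp φ = AlgHom.id k _ := algHom_ext (by simp [φ])
  have hb : T.val (φ b) = b := DFunLike.congr_fun h b
  exact hb ▸ (φ b).2

variable [Fact p.Prime] [CharP k p]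

/-- The comultiplication: `Δ(y) = y ⊗ 1 + 1 ⊗ y`. -/
def comulHom : TruncPoly k p →ₐ[k] TruncPoly k p ⊗[k] TruncPoly k p :=
  lift (y k p ⊗ₜ[k] 1 + 1 ⊗ₜ[k] y k p) (by
    rw [add_pow_of_commute_of_charP k p (Commute.all _ _)]
    simp [y_pow])

/-- The counit: `ε(y) = 0`. -/
def counitHom : TruncPoly k p →ₐ[k] k :=
  lift 0 (zero_pow (Fact.out : p.Prime).ne_zero)

instance instBialgebra : Bialgebra k (TruncPoly k p) :=
  Bialgebra.ofAlgHom (comulHom k p) (counitHom k p)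
    (algHom_ext (by
      simp [comulHom, TensorProduct.add_tmul, TensorProduct.tmul_add,
        Algebra.TensorProduct.one_def, add_assoc]))
    (algHom_ext (by simp [comulHom, counitHom]))
    (algHom_ext (by simp [comulHom, counitHom]))

@[simp]
theorem comul_y : Coalgebra.comul (R := k) (y k p) = y k p ⊗ₜ[k] 1 + 1 ⊗ₜ[k] y k p := by
  change comulHom k p (y k p) = _
  simp [comulHom]

@[simp]
theorem counit_y : Coalgebra.counit (R := k) (y k p) = 0 := by
  change counitHom k p (y k p) = _
  simp [counitHom]

/-- The antipode: `S(y) = - y`. -/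
def antipodeHom : TruncPoly k p →ₐ[k] (TruncPoly k p)ᵐᵒᵖ :=
  lift (.op (-y k p)) (by
    rw [← MulOpposite.op_pow, neg_pow, y_pow, mul_zero, MulOpposite.op_zero])

instance instHopfAlgebra : HopfAlgebra k (TruncPoly k p) :=
  HopfAlgebra.ofGenerators (antipodeHom k p) {y k p} (adjoin_eq_top k p)
    (by
      rintro b rfl
      simp [antipodeHom])
    (by
      rintro b rfl
      simp [antipodeHom])

end TruncPoly

/-! ### The Hopf algebra `A_{4p}` -/

/-- The names of the two generators of `A_{4p}`. -/
inductive FourPGen : Type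
  | g
  | x

/-- The defining relations `x ^ (2 p) = 0`, `g² = 1`, `x g = - g x` of `A_{4p}`. -/
inductive FourPRel (k : Type*) [Field k] (p : ℕ) :
    FreeAlgebra k FourPGen → FreeAlgebra k FourPGen → Prop
  | x_pow : FourPRel k p (FreeAlgebra.ι k FourPGen.x ^ (2 * p)) 0
  | g_sq : FourPRel k p (FreeAlgebra.ι k FourPGen.g ^ 2) 1
  | x_g : FourPRel k p (FreeAlgebra.ι k FourPGen.x * FreeAlgebra.ι k FourPGen.g)
      (-(FreeAlgebra.ι k FourPGen.g * FreeAlgebra.ι k FourPGen.x))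

/-- The algebra `A_{4p}` generated by `g` and `x` subject to the relations
`x ^ (2 p) = 0`, `g² = 1`, `x g = - g x`. -/
def FourP (k : Type*) [Field k] (p : ℕ) : Type _ := RingQuot (FourPRel k p)

namespace FourP

variable (k : Type*) [Field k] (p : ℕ)

instance instRing : Ring (FourP k p) := inferInstanceAs (Ring (RingQuot (FourPRel k p)))

instance instAlgebra : Algebra k (FourP k p) :=
  inferInstanceAs (Algebra k (RingQuot (FourPRel k p)))

/-- The generator `g`. -/
def g : FourP k p := RingQuot.mkAlgHom k (FourPRel k p) (FreeAlgebra.ι k FourPGen.g)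

/-- The generator `x`. -/
def x : FourP k p := RingQuot.mkAlgHom k (FourPRel k p) (FreeAlgebra.ι k FourPGen.x)

theorem x_pow : x k p ^ (2 * p) = 0 := by
  have h := RingQuot.mkAlgHom_rel k (FourPRel.x_pow (k := k) (p := p))
  rwa [map_pow, map_zero] at h

theorem g_mul_g : g k p * g k p = 1 := by
  have h := RingQuot.mkAlgHom_rel k (FourPRel.g_sq (k := k) (p := p))
  rwa [map_pow, map_one, pow_two] at h

theorem x_mul_g : x k p * g k p = -(g k p * x k p) := by
  have h := RingQuot.mkAlgHom_rel k (FourPRel.x_g (k := k) (p := p))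
  rwa [map_neg, map_mul, map_mul] at h

variable {k p}

/-- The algebra map out of `A_{4p}` given by the images of `g` and `x`. -/
def lift {B : Type*} [Ring B] [Algebra k B] (G X : B) (hX : X ^ (2 * p) = 0) (hG : G * G = 1)
    (hXG : X * G = -(G * X)) : FourP k p →ₐ[k] B :=
  RingQuot.liftAlgHom k
    ⟨FreeAlgebra.lift k (fun t => match t with
        | FourPGen.g => G
        | FourPGen.x => X), by
      rintro _ _ (_ | _ | _)
      · simpa using hX
      · simpa [pow_two] using hG
      · simpa using hXG⟩

@[simp]
theorem lift_g {B : Type*} [Ring B] [Algebra k B] (G X : B) (hX hG hXG) :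
    lift (k := k) (p := p) G X hX hG hXG (g k p) = G := by
  refine (RingQuot.liftAlgHom_mkAlgHom_apply ..).trans ?_
  simp

@[simp]
theorem lift_x {B : Type*} [Ring B] [Algebra k B] (G X : B) (hX hG hXG) :
    lift (k := k) (p := p) G X hX hG hXG (x k p) = X := by
  refine (RingQuot.liftAlgHom_mkAlgHom_apply ..).trans ?_
  simp

theorem algHom_ext {B : Type*} [Ring B] [Algebra k B] {φ ψ : FourP k p →ₐ[k] B}
    (hg : φ (g k p) = ψ (g k p)) (hx : φ (x k p) = ψ (x k p)) : φ = ψ := by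
  refine RingQuot.ringQuot_ext' k φ ψ (FreeAlgebra.hom_ext (funext fun t => ?_))
  cases t
  · exact hg
  · exact hx

variable (k p)

theorem adjoin_eq_top : Algebra.adjoin k {g k p, x k p} = ⊤ := by
  rw [eq_top_iff]
  intro b _
  let T := Algebra.adjoin k {g k p, x k p}
  let φ : FourP k p →ₐ[k] T := lift ⟨g k p, Algebra.subset_adjoin (by simp)⟩
    ⟨x k p, Algebra.subset_adjoin (by simp)⟩ (Subtype.ext (x_pow k p))
    (Subtype.ext (g_mul_g k p)) (Subtype.ext (x_mul_g k p))
  have h : T.val.comp φ = AlgHom.id k _ := algHom_ext (by simp [φ]) (by simp [φ])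
  have hb : T.val (φ b) = b := DFunLike.congr_fun h b
  exact hb ▸ (φ b).2

theorem skew_sq : (g k p * x k p) ^ 2 = -x k p ^ 2 := by
  rw [pow_two, mul_assoc, ← mul_assoc (x k p), x_mul_g, neg_mul, mul_neg, mul_assoc, ← mul_assoc,
    g_mul_g, one_mul, pow_two]

variable [Fact p.Prime] [CharP k p]

theorem comul_x_pow :
    (x k p ⊗ₜ[k] (1 : FourP k p) + g k p ⊗ₜ[k] x k p) ^ (2 * p) = 0 := by
  have h : (x k p ⊗ₜ[k] (1 : FourP k p) + g k p ⊗ₜ[k] x k p) ^ 2 =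
      (x k p ^ 2) ⊗ₜ[k] 1 + 1 ⊗ₜ[k] (x k p ^ 2) := by
    simp only [pow_two, mul_add, add_mul, Algebra.TensorProduct.tmul_mul_tmul, g_mul_g, x_mul_g,
      mul_one, one_mul, TensorProduct.neg_tmul]
    abel
  rw [pow_mul, h, add_pow_of_commute_of_charP k p]
  · simp [← pow_mul, x_pow]
  · simp [Commute, SemiconjBy]

/-- The comultiplication: `Δ(g) = g ⊗ g`, `Δ(x) = x ⊗ 1 + g ⊗ x`. -/
def comulHom : FourP k p →ₐ[k] FourP k p ⊗[k] FourP k p :=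
  lift (g k p ⊗ₜ[k] g k p) (x k p ⊗ₜ[k] 1 + g k p ⊗ₜ[k] x k p)
    (comul_x_pow k p)
    (by simp [g_mul_g, Algebra.TensorProduct.one_def])
    (by simp [mul_add, add_mul, x_mul_g, g_mul_g, TensorProduct.neg_tmul, TensorProduct.tmul_neg,
      add_comm])

/-- The counit: `ε(g) = 1`, `ε(x) = 0`. -/
def counitHom : FourP k p →ₐ[k] k :=
  lift 1 0 (zero_pow (mul_ne_zero two_ne_zero (Fact.out : p.Prime).ne_zero)) (by simp) (by simp)

instance instBialgebra : Bialgebra k (FourP k p) :=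
  Bialgebra.ofAlgHom (comulHom k p) (counitHom k p)
    (algHom_ext (by simp [comulHom])
      (by simp [comulHom, TensorProduct.add_tmul, TensorProduct.tmul_add,
        Algebra.TensorProduct.one_def, add_assoc]))
    (algHom_ext (by simp [comulHom, counitHom]) (by simp [comulHom, counitHom]))
    (algHom_ext (by simp [comulHom, counitHom]) (by simp [comulHom, counitHom]))

@[simp]
theorem comul_g : Coalgebra.comul (R := k) (g k p) = g k p ⊗ₜ[k] g k p := by
  change comulHom k p (g k p) = _
  simp [comulHom]

@[simp]
theorem comul_x : Coalgebra.comul (R := k) (x k p) = x k p ⊗ₜ[k] 1 + g k p ⊗ₜ[k] x k p := by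
  change comulHom k p (x k p) = _
  simp [comulHom]

@[simp]
theorem counit_g : Coalgebra.counit (R := k) (g k p) = 1 := by
  change counitHom k p (g k p) = _
  simp [counitHom]

@[simp]
theorem counit_x : Coalgebra.counit (R := k) (x k p) = 0 := by
  change counitHom k p (x k p) = _
  simp [counitHom]

/-- The antipode: `S(g) = g`, `S(x) = - g x`, extended as an anti-homomorphism. -/
def antipodeHom : FourP k p →ₐ[k] (FourP k p)ᵐᵒᵖ :=
  lift (.op (g k p)) (.op (-(g k p * x k p)))
    (by
      rw [← MulOpposite.op_pow, pow_mul, neg_sq, skew_sq, neg_pow, ← pow_mul, x_pow, mul_zero,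
        MulOpposite.op_zero])
    (by rw [← MulOpposite.op_mul, g_mul_g, MulOpposite.op_one])
    (by
      rw [← MulOpposite.op_mul, ← MulOpposite.op_mul, ← MulOpposite.op_neg, mul_neg, neg_mul,
        neg_neg, mul_assoc, x_mul_g, mul_neg])

instance instHopfAlgebra : HopfAlgebra k (FourP k p) :=
  HopfAlgebra.ofGenerators (antipodeHom k p) {g k p, x k p} (adjoin_eq_top k p)
    (by
      rintro b (rfl | rfl)
      · simp [antipodeHom, g_mul_g]
      · simp [antipodeHom])
    (by
      rintro b (rfl | rfl)
      · simp [antipodeHom, g_mul_g]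
      · simp [antipodeHom, ← mul_assoc, g_mul_g])

end FourP

end

/-! The rigidity comes from multiplicativity of Δ on A # H. An element u of A ⊗ H is recovered from
Δ(u) by pairing the projections to A and H, in either order (`map_fst_snd_comul`,
`map_snd_fst_comul`). Applied to products in A # H, the second order gives h₁▷c ⊗ h₂ = h₂▷c ⊗ h₁
(`IsCrossedSystem.comm_act`) and f(h₁,g₁) ⊗ h₂g₂ = f(h₂,g₂) ⊗ h₁g₁
(`IsCrossedSystem.comm_cocycleMul`).

Since H₄ is far from cocommutative, comparing coefficients of 1, g, x, gx makes the action trivial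
(`Sweedler.act_eq_trivialAct`) and normalises f on all pairs involving g
(`Sweedler.cocycle_values`). As f is a coalgebra map, f(x,x) is then primitive, hence equal to l y
for some l in k (`TruncPoly.exists_eq_smul_y`), and associativity determines the remaining values
(`Sweedler.exists_eq_cocycle`). The same comparison shows that unitary cocentral maps are trivial
(`Sweedler.cocentral_eq`), so cohomologous crossed systems are equal and H² is the line of
parameters l.

Existence for every l is obtained by transport of structure (`IsWeakAction.isCrossedSystem`). For l
= 0 the crossed multiplication is that of A ⊗ H₄. For l ≠ 0, x² is central and primitive in A_{4p},
and y ↦ l⁻¹x², g ↦ g, x ↦ x defines a coalgebra map from A ⊗ H₄ that carries the crossed product to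
the product. It is injective because A_{4p} acts on a quaternion algebra over A with i² = 1, j² = l
y, and surjective because it hits the generators. So every l ≠ 0 gives the same Hopf algebra.

An isomorphism between the algebras in question preserves the unique nontrivial group-like element,
and it sends x to some a(1-g) + cx. Anticommutation with g and 2 ≠ 0 force a = 0. Since x² vanishes
in A ⊗ H₄ but not in A_{4p}, the two are not isomorphic. Automorphisms scale y and x independently
in the first case, and only x in the second. -/

noncomputable section


/-! ### Group-like and primitive elements of k[y]/(y^p), by first-order Taylor expansion -/

namespace TruncPoly

open Polynomial

variable (k : Type*) [Field k] (p : ℕ)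

theorem aeval_eq_mk (f : k[X]) : aeval (y k p) f = AdjoinRoot.mk (X ^ p) f :=
  AdjoinRoot.aeval_eq f

variable {k p}

theorem exists_aeval_eq (v : TruncPoly k p) :
    ∃ f : k[X], f.degree < p ∧ aeval (y k p) f = v := by
  obtain ⟨f, hf⟩ := AdjoinRoot.mk_surjective (g := (X : k[X]) ^ p) v
  refine ⟨f %ₘ X ^ p, ?_, ?_⟩
  · simpa using! degree_modByMonic_lt f (monic_X_pow (R := k) p)
  · rw [aeval_eq_mk]
    refine Eq.trans ?_ hf
    refine (AdjoinRoot.mk_eq_mk).2 ?_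
    rw [modByMonic_eq_sub_mul_div]
    exact ⟨-(f /ₘ X ^ p), by ring⟩

theorem eq_zero_of_aeval_eq_zero {f : k[X]} (hf : f.degree < p) (h : aeval (y k p) f = 0) :
    f = 0 := by
  rw [aeval_eq_mk] at h
  have h' : (X : k[X]) ^ p ∣ f := AdjoinRoot.mk_eq_zero.1 h
  exact eq_zero_of_dvd_of_degree_lt h' (by simpa using hf)

variable (k p)

theorem finrank_eq : Module.finrank k (TruncPoly k p) = p := by
  have h := finrank_quotient_span_eq_natDegree (f := (X : k[X]) ^ p)
  rw [natDegree_X_pow] at h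
  exact h

theorem y_ne_zero (hp : 1 < p) : y k p ≠ 0 := by
  intro h
  refine X_ne_zero (eq_zero_of_aeval_eq_zero (f := (X : k[X])) (p := p) ?_ (by simpa using h))
  rw [degree_X]
  exact_mod_cast hp

instance instNontrivial [Fact p.Prime] : Nontrivial (TruncPoly k p) :=
  ⟨_, _, y_ne_zero k p (Fact.out : p.Prime).one_lt⟩

variable [Fact p.Prime]

/-- The algebra map `TruncPoly k p → k[ε]` with `y ↦ ε`. -/
def toDual : TruncPoly k p →ₐ[k] TrivSqZeroExt (TruncPoly k p) (TruncPoly k p) :=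
  lift (TrivSqZeroExt.inr 1) (by
    obtain ⟨n, hn⟩ := Nat.exists_eq_add_of_le (Fact.out : p.Prime).two_le
    rw [hn, pow_add, pow_two, TrivSqZeroExt.inr_mul_inr, zero_mul])

variable {k p}

/-- Since ε² = 0, only the first-order Taylor polynomial at 0 survives. -/
theorem toDual_aeval (f : k[X]) : toDual k p (aeval (y k p) f) =
    TrivSqZeroExt.inl (algebraMap k _ (f.coeff 0)) +
      TrivSqZeroExt.inr (algebraMap k _ (f.coeff 1)) := by
  have h := f.aeval_add_of_sq_eq_zero (0 : TrivSqZeroExt (TruncPoly k p) (TruncPoly k p))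
    (TrivSqZeroExt.inr 1) (by rw [pow_two, TrivSqZeroExt.inr_mul_inr])
  rw [← aeval_algHom_apply, toDual, lift_y]
  rw [zero_add] at h
  rw [h]
  ext <;> simp [aeval_def, eval₂_at_zero, coeff_derivative, TrivSqZeroExt.algebraMap_eq_inl',
    Algebra.smul_def]

theorem natDegree_lt_of_degree_lt {f : k[X]} (hf : f.degree < p) : f.natDegree < p := by
  rcases eq_or_ne f 0 with rfl | h0
  · simpa using (Fact.out : p.Prime).pos
  · exact (natDegree_lt_iff_degree_lt h0).2 hf

variable [CharP k p]

/-- Taylor expansion to first order factors through the comultiplication. -/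
theorem productMap_comul (f : k[X]) :
    Algebra.TensorProduct.productMap (TrivSqZeroExt.inlAlgHom k (TruncPoly k p) (TruncPoly k p))
      (toDual k p) (Coalgebra.comul (R := k) (aeval (y k p) f)) =
    TrivSqZeroExt.inl (aeval (y k p) f) +
      TrivSqZeroExt.inr (aeval (y k p) (derivative f)) := by
  have h := f.aeval_add_of_sq_eq_zero
    (TrivSqZeroExt.inl (y k p) : TrivSqZeroExt (TruncPoly k p) (TruncPoly k p))
    (TrivSqZeroExt.inr 1) (by rw [pow_two, TrivSqZeroExt.inr_mul_inr])
  have e (q : k[X]) : aeval (TrivSqZeroExt.inl (y k p) :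
      TrivSqZeroExt (TruncPoly k p) (TruncPoly k p)) q = TrivSqZeroExt.inl (aeval (y k p) q) :=
    aeval_algHom_apply (TrivSqZeroExt.inlAlgHom k (TruncPoly k p) (TruncPoly k p)) _ _
  rw [e, e] at h
  have h2 : Algebra.TensorProduct.productMap
      (TrivSqZeroExt.inlAlgHom k (TruncPoly k p) (TruncPoly k p)) (toDual k p)
      (Coalgebra.comul (R := k) (y k p)) = TrivSqZeroExt.inl (y k p) + TrivSqZeroExt.inr 1 := by
    simp [toDual]
  rw [← Bialgebra.comulAlgHom_apply, ← aeval_algHom_apply, ← aeval_algHom_apply,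
    Bialgebra.comulAlgHom_apply, h2, h]
  ext <;> simp

/-- Below degree p, differentiation loses only the constant term, because n + 1 is invertible in k
for n + 1 < p. -/
theorem coeff_eq_zero_of_coeff_derivative {f : k[X]} (hf : f.degree < p) {n : ℕ}
    (h : (derivative f).coeff n = 0) : f.coeff (n + 1) = 0 := by
  by_cases hn : n + 1 < p
  · rw [coeff_derivative] at h
    refine (mul_eq_zero.1 h).resolve_right ?_
    have h2 : ((n + 1 : ℕ) : k) ≠ 0 := by
      rw [Ne, CharP.cast_eq_zero_iff k p]
      exact fun h => absurd (Nat.le_of_dvd n.succ_pos h) (by omega)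
    exact_mod_cast h2
  · exact coeff_eq_zero_of_natDegree_lt (by have := natDegree_lt_of_degree_lt hf; omega)

/-- The primitive elements of `k⟨y | y ^ p = 0⟩` are the multiples of `y`. -/
theorem exists_eq_smul_y {v : TruncPoly k p}
    (hv : Coalgebra.comul (R := k) v = v ⊗ₜ[k] 1 + 1 ⊗ₜ[k] v) : ∃ c : k, v = c • y k p := by
  obtain ⟨f, hf, rfl⟩ := exists_aeval_eq v
  have h := productMap_comul (k := k) (p := p) f
  rw [hv] at h
  simp only [map_add, Algebra.TensorProduct.productMap_apply_tmul, map_one, mul_one, one_mul,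
    toDual_aeval, TrivSqZeroExt.inlAlgHom_apply] at h
  -- Writing v = f(y), the part without ε gives f(0) = 0 and the ε-part gives f'(y) = f₁, the linear
  -- coefficient. Both sides of the latter have degree below p, so it holds already in k[X].
  have h0 := congrArg TrivSqZeroExt.fst h
  have h1 := congrArg TrivSqZeroExt.snd h
  simp at h0 h1
  have hd : derivative f = C (f.coeff 1) := by
    rw [← sub_eq_zero]
    refine eq_zero_of_aeval_eq_zero (p := p) ?_ 
      (by rw [map_sub, ← h1, aeval_C, Algebra.algebraMap_eq_smul_one, sub_self])
    refine (degree_sub_le _ _).trans_lt (max_lt (degree_derivative_le.trans_lt hf) ?_)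
    exact degree_C_le.trans_lt (by exact_mod_cast (Fact.out : p.Prime).pos)
  refine ⟨f.coeff 1, ?_⟩
  have hfe : f = C (f.coeff 1) * X := by
    ext n
    rcases n with _ | _ | n
    · simp [h0]
    · simp
    · rw [coeff_eq_zero_of_coeff_derivative hf (by rw [hd, coeff_C_succ])]
      simp
  conv_lhs => rw [hfe]
  simp [Algebra.smul_def]

/-- The only group-like element of `k⟨y | y ^ p = 0⟩` is `1`. -/
theorem eq_one_of_isGroupLikeElem {v : TruncPoly k p} (hv : IsGroupLikeElem k v) : v = 1 := by
  obtain ⟨f, hf, rfl⟩ := exists_aeval_eq v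
  have h := productMap_comul (k := k) (p := p) f
  rw [hv.comul_eq_tmul_self] at h
  simp only [Algebra.TensorProduct.productMap_apply_tmul, toDual_aeval,
    TrivSqZeroExt.inlAlgHom_apply] at h
  have h1 := congrArg TrivSqZeroExt.snd h
  simp at h1
  have hf0 : f ≠ 0 := by
    rintro rfl
    exact hv.ne_zero (by simp)
  -- The ε-part of f(y + ε) = f(y)(f₀ + f₁ε) is an equation f' = f₁f between polynomials of degree
  -- below p; comparing degrees then forces f₁ = 0.
  have hd : derivative f = C (f.coeff 1) * f := by
    rw [← sub_eq_zero]
    refine eq_zero_of_aeval_eq_zero (p := p) ?_ 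
      (by rw [map_sub, map_mul, ← h1, aeval_C, Algebra.smul_def, sub_self])
    refine (degree_sub_le _ _).trans_lt (max_lt (degree_derivative_le.trans_lt hf) ?_)
    exact (C_mul' (f.coeff 1) f ▸ degree_smul_le _ _).trans_lt hf
  have hc : f.coeff 1 = 0 := by
    by_contra hc
    have := degree_derivative_lt hf0
    rw [hd, degree_C_mul hc] at this
    exact lt_irrefl _ this
  have hfe : f = C (f.coeff 0) := by
    ext n
    rcases n with _ | n
    · simp
    · rw [coeff_eq_zero_of_coeff_derivative hf (by rw [hd, hc]; simp)]
      simp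
  have he := hv.counit_eq_one
  rw [hfe] at he ⊢
  simp only [aeval_C] at he ⊢
  rw [Bialgebra.counit_algebraMap] at he
  rw [he, map_one]

end TruncPoly


/-! ### Coordinates in V ⊗ H₄; group-like and skew-primitive elements of H₄ -/

namespace Sweedler

variable (k : Type*) [Field k]

theorem g_mul_gx : g k * (g k * x k) = x k := by rw [← mul_assoc, g_mul_g, one_mul]

theorem x_mul_gx : x k * (g k * x k) = 0 := by
  rw [← mul_assoc, x_mul_g, neg_mul, mul_assoc, x_mul_x, mul_zero, neg_zero]

theorem gx_mul_g : g k * x k * g k = -x k := by rw [mul_assoc, x_mul_g, mul_neg, g_mul_gx]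

theorem gx_mul_x : g k * x k * x k = 0 := by rw [mul_assoc, x_mul_x, mul_zero]

theorem gx_mul_gx : g k * x k * (g k * x k) = 0 := by rw [mul_assoc, x_mul_gx, mul_zero]

theorem comul_gx : Coalgebra.comul (R := k) (g k * x k) =
    (g k * x k) ⊗ₜ[k] g k + 1 ⊗ₜ[k] (g k * x k) := by
  rw [Bialgebra.comul_mul, comul_g, comul_x, mul_add, Algebra.TensorProduct.tmul_mul_tmul,
    Algebra.TensorProduct.tmul_mul_tmul, g_mul_g, mul_one]

theorem counit_gx : Coalgebra.counit (R := k) (g k * x k) = 0 := by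
  rw [Bialgebra.counit_mul, counit_x, mul_zero]

variable {k}

/-- A linear map out of `H₄` is determined by its values on `1`, `g`, `x`, `g x`. -/
theorem linearMap_ext {V : Type*} [AddCommGroup V] [Module k V] {φ ψ : Sweedler k →ₗ[k] V}
    (h1 : φ 1 = ψ 1) (hg : φ (g k) = ψ (g k)) (hx : φ (x k) = ψ (x k))
    (hgx : φ (g k * x k) = ψ (g k * x k)) : φ = ψ := by
  refine (basis k).ext fun i => ?_
  rw [basis_eq]
  fin_cases i <;> assumption

section Coordinates

variable {V : Type*} [AddCommGroup V] [Module k V]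

/-- The coordinates of an element of `V ⊗ H₄`. -/
def coordR (V : Type*) [AddCommGroup V] [Module k V] (i : Fin 4) : V ⊗[k] Sweedler k →ₗ[k] V :=
  (TensorProduct.rid k V).toLinearMap ∘ₗ ((basis k).coord i).lTensor V

theorem coord_apply (i j : Fin 4) :
    (basis k).coord i (![1, g k, x k, g k * x k] j) = if i = j then 1 else 0 := by
  rw [← basis_eq, Module.Basis.coord_apply, Module.Basis.repr_self, Finsupp.single_apply]
  simp [eq_comm]

theorem coord_one (i : Fin 4) : (basis k).coord i 1 = if i = 0 then 1 else 0 :=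
  coord_apply i 0

theorem coord_g (i : Fin 4) : (basis k).coord i (g k) = if i = 1 then 1 else 0 :=
  coord_apply i 1

theorem coord_x (i : Fin 4) : (basis k).coord i (x k) = if i = 2 then 1 else 0 :=
  coord_apply i 2

theorem coord_gx (i : Fin 4) : (basis k).coord i (g k * x k) = if i = 3 then 1 else 0 :=
  coord_apply i 3

theorem coordR_sum (v₀ v₁ v₂ v₃ : V) (i : Fin 4) :
    coordR V i (v₀ ⊗ₜ[k] 1 + v₁ ⊗ₜ[k] g k + v₂ ⊗ₜ[k] x k + v₃ ⊗ₜ[k] (g k * x k)) =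
      ![v₀, v₁, v₂, v₃] i := by
  simp only [coordR, LinearMap.comp_apply, LinearEquiv.coe_coe, map_add, LinearMap.lTensor_tmul,
    coord_one, coord_g, coord_x, coord_gx, TensorProduct.rid_tmul]
  fin_cases i <;> simp

/-- All later comparisons of coefficients rest on this. A basis vector that does not occur must be
given the coefficient 0, which is why callers often name the vectors explicitly. -/
theorem tmul_inj {v₀ v₁ v₂ v₃ w₀ w₁ w₂ w₃ : V}
    (h : v₀ ⊗ₜ[k] 1 + v₁ ⊗ₜ[k] g k + v₂ ⊗ₜ[k] x k + v₃ ⊗ₜ[k] (g k * x k) =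
      w₀ ⊗ₜ[k] 1 + w₁ ⊗ₜ[k] g k + w₂ ⊗ₜ[k] x k + w₃ ⊗ₜ[k] (g k * x k)) :
    v₀ = w₀ ∧ v₁ = w₁ ∧ v₂ = w₂ ∧ v₃ = w₃ := by
  have H (i : Fin 4) := congrArg (coordR V i) h
  simp only [coordR_sum] at H
  exact ⟨H 0, H 1, H 2, H 3⟩

theorem exists_tmul_eq (u : V ⊗[k] Sweedler k) : ∃ v₀ v₁ v₂ v₃ : V,
    u = v₀ ⊗ₜ[k] 1 + v₁ ⊗ₜ[k] g k + v₂ ⊗ₜ[k] x k + v₃ ⊗ₜ[k] (g k * x k) := by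
  induction u with
  | zero => exact ⟨0, 0, 0, 0, by simp⟩
  | add a b ha hb =>
    obtain ⟨v₀, v₁, v₂, v₃, rfl⟩ := ha
    obtain ⟨w₀, w₁, w₂, w₃, rfl⟩ := hb
    refine ⟨v₀ + w₀, v₁ + w₁, v₂ + w₂, v₃ + w₃, ?_⟩
    simp only [TensorProduct.add_tmul]
    abel
  | tmul v h =>
    refine ⟨(basis k).repr h 0 • v, (basis k).repr h 1 • v, (basis k).repr h 2 • v,
      (basis k).repr h 3 • v, ?_⟩
    conv_lhs => rw [← (basis k).sum_repr h, Fin.sum_univ_four]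
    simp [basis_eq, TensorProduct.tmul_add, TensorProduct.smul_tmul]

theorem exists_eq (h : Sweedler k) : ∃ a b c d : k,
    h = a • 1 + b • g k + c • x k + d • (g k * x k) :=
  ⟨_, _, _, _, by
    conv_lhs => rw [← (basis k).sum_repr h, Fin.sum_univ_four]
    simp only [basis_eq]
    rfl⟩

theorem smul_inj {a b c d a' b' c' d' : k}
    (h : a • 1 + b • g k + c • x k + d • (g k * x k) =
      a' • 1 + b' • g k + c' • x k + d' • (g k * x k)) :
    a = a' ∧ b = b' ∧ c = c' ∧ d = d' := by
  refine tmul_inj (k := k) ((TensorProduct.lid k (Sweedler k)).injective ?_)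
  simpa using h

end Coordinates

/-- Grouped by the right tensor factor, so that `tmul_inj` yields one equation in H₄ for each basis
vector. -/
theorem comul_eq (a b c d : k) :
    Coalgebra.comul (R := k) (a • 1 + b • g k + c • x k + d • (g k * x k)) =
      (a • 1 + c • x k) ⊗ₜ[k] 1 + (b • g k + d • (g k * x k)) ⊗ₜ[k] g k + (c • g k) ⊗ₜ[k] x k +
        (d • 1) ⊗ₜ[k] (g k * x k) := by
  simp only [map_add, map_smul, comul_g, comul_x, comul_gx, Bialgebra.comul_one,
    Algebra.TensorProduct.one_def, TensorProduct.add_tmul, TensorProduct.smul_tmul', smul_add]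
  abel

theorem tmul_eq (h : Sweedler k) (a b c d : k) :
    h ⊗ₜ[k] (a • 1 + b • g k + c • x k + d • (g k * x k)) =
      (a • h) ⊗ₜ[k] 1 + (b • h) ⊗ₜ[k] g k + (c • h) ⊗ₜ[k] x k + (d • h) ⊗ₜ[k] (g k * x k) := by
  simp only [TensorProduct.tmul_add, TensorProduct.tmul_smul, TensorProduct.smul_tmul']

/-- Comparing coefficients gives c² = d² = 0 and ab = 0, while the counit gives a + b = 1. -/
theorem eq_one_or_eq_g {h : Sweedler k} (hh : IsGroupLikeElem k h) : h = 1 ∨ h = g k := by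
  obtain ⟨a, b, c, d, rfl⟩ := exists_eq h
  have h1 := hh.comul_eq_tmul_self
  have h2 := hh.counit_eq_one
  rw [comul_eq, tmul_eq] at h1
  obtain ⟨e1, e2, e3, e4⟩ := tmul_inj h1
  simp only [map_add, map_smul, counit_g, counit_x, counit_gx, Bialgebra.counit_one, smul_eq_mul,
    mul_one, mul_zero, add_zero] at h2
  simp only [smul_add, smul_smul] at e1 e2 e3 e4
  have e1' := smul_inj (k := k) (a := a) (b := 0) (c := c) (d := 0) (by simpa using e1)
  have e2' := smul_inj (k := k) (a := 0) (b := b) (c := 0) (d := d) (by simpa using e2)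
  have e3' := smul_inj (k := k) (a := 0) (b := c) (c := 0) (d := 0) (by simpa using e3)
  have e4' := smul_inj (k := k) (a := d) (b := 0) (c := 0) (d := 0) (by simpa using e4)
  have hc : c = 0 := by simpa using e3'.2.2.1.symm
  have hd : d = 0 := by simpa using e4'.2.2.2.symm
  subst hc hd
  have hab : a * b = 0 := e1'.2.1.symm
  rcases mul_eq_zero.1 hab with rfl | rfl
  · right
    have : b = 1 := by simpa using h2
    simp [this]
  · left
    have : a = 1 := by simpa using h2
    simp [this]

theorem eq_zero_of_primitive {h : Sweedler k}
    (hh : Coalgebra.comul (R := k) h = h ⊗ₜ[k] 1 + 1 ⊗ₜ[k] h) : h = 0 := by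
  obtain ⟨a, b, c, d, rfl⟩ := exists_eq h
  rw [comul_eq, tmul_eq] at hh
  -- The term 1 ⊗ h contributes a to the coefficient of ⊗ 1, which becomes h + a. This forces a = a
  -- + a and b = d = 0, and the coefficient of ⊗ x, namely c g = c 1, kills c.
  obtain ⟨e1, e2, e3, e4⟩ := tmul_inj (v₀ := a • 1 + c • x k)
    (w₀ := (a • 1 + b • g k + c • x k + d • (g k * x k)) + a • 1) (hh.trans (by
      simp only [TensorProduct.add_tmul]
      abel))
  have e1' := smul_inj (k := k) (a := a) (b := 0) (c := c) (d := 0)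
    (a' := a + a) (b' := b) (c' := c) (d' := d) (by
      simp only [zero_smul, add_zero]; rw [e1, add_smul]; abel)
  have e3' := smul_inj (k := k) (a := 0) (b := c) (c := 0) (d := 0)
    (a' := c) (b' := 0) (c' := 0) (d' := 0) (by simpa using e3)
  have ha : a = 0 := by simpa using e1'.1
  simp [ha, ← e1'.2.1, ← e1'.2.2.2, e3'.2.1]

/-- The coefficient of ⊗ 1 suffices: a + cx = h + ag gives b = -a and d = 0. -/
theorem exists_eq_of_skewPrimitive {h : Sweedler k}
    (hh : Coalgebra.comul (R := k) h = h ⊗ₜ[k] 1 + g k ⊗ₜ[k] h) :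
    ∃ a c : k, h = a • (1 - g k) + c • x k := by
  obtain ⟨a, b, c, d, rfl⟩ := exists_eq h
  rw [comul_eq, tmul_eq] at hh
  obtain ⟨e1, e2, e3, e4⟩ := tmul_inj (v₀ := a • 1 + c • x k)
    (w₀ := (a • 1 + b • g k + c • x k + d • (g k * x k)) + a • g k) (hh.trans (by
      simp only [TensorProduct.add_tmul]
      abel))
  have e1' := smul_inj (k := k) (a := a) (b := 0) (c := c) (d := 0)
    (a' := a) (b' := b + a) (c' := c) (d' := d) (by
      simp only [zero_smul, add_zero]; rw [e1, add_smul]; abel)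
  refine ⟨a, c, ?_⟩
  rw [← e1'.2.2.2, eq_neg_of_add_eq_zero_left e1'.2.1.symm, smul_sub, neg_smul, zero_smul, add_zero,
    ← sub_eq_add_neg]

end Sweedler

/-! ### The coalgebra `A ⊗ H` -/

section TensorCoalgebra

variable {k A H : Type*} [Field k] [Ring A] [Ring H] [Bialgebra k A] [Bialgebra k H]

variable (k A H) in
/-- The projection `id ⊗ ε : A ⊗ H → A`. -/
def tensorFst : A ⊗[k] H →ₐc[k] A :=
  ((Bialgebra.TensorProduct.rid k k A : A ⊗[k] k ≃ₐc[k] A) : A ⊗[k] k →ₐc[k] A).comp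
    (Bialgebra.TensorProduct.map (BialgHom.id k A) (Bialgebra.counitBialgHom k H))

variable (k A H) in
/-- The projection `ε ⊗ id : A ⊗ H → H`. -/
def tensorSnd : A ⊗[k] H →ₐc[k] H :=
  ((Bialgebra.TensorProduct.lid k H : k ⊗[k] H ≃ₐc[k] H) : k ⊗[k] H →ₐc[k] H).comp
    (Bialgebra.TensorProduct.map (Bialgebra.counitBialgHom k A) (BialgHom.id k H))

@[simp]
theorem tensorFst_tmul (a : A) (h : H) :
    tensorFst k A H (a ⊗ₜ[k] h) = Coalgebra.counit (R := k) h • a := rfl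

@[simp]
theorem tensorSnd_tmul (a : A) (h : H) :
    tensorSnd k A H (a ⊗ₜ[k] h) = Coalgebra.counit (R := k) a • h := rfl

/-- For u = a ⊗ h the left side is a₁ε(h₁) ⊗ ε(a₂)h₂, which collapses by the counit axioms. -/
theorem map_fst_snd_comul (u : A ⊗[k] H) :
    TensorProduct.map (tensorFst k A H : A ⊗[k] H →ₗ[k] A) (tensorSnd k A H : A ⊗[k] H →ₗ[k] H)
      (Coalgebra.comul (R := k) u) = u := by
  have key (s : A ⊗[k] A) (t : H ⊗[k] H) :
      TensorProduct.map (tensorFst k A H : A ⊗[k] H →ₗ[k] A) (tensorSnd k A H : A ⊗[k] H →ₗ[k] H)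
        (TensorProduct.AlgebraTensorModule.tensorTensorTensorComm k k k k A A H H (s ⊗ₜ[k] t)) =
      TensorProduct.rid k A ((Coalgebra.counit (R := k) (A := A)).lTensor A s) ⊗ₜ[k]
        TensorProduct.lid k H ((Coalgebra.counit (R := k) (A := H)).rTensor H t) := by
    induction s with
    | zero => simp
    | add s₁ s₂ h₁ h₂ => simp only [TensorProduct.add_tmul, map_add, h₁, h₂]
    | tmul a b =>
      induction t with
      | zero => simp
      | add t₁ t₂ h₁ h₂ => simp only [TensorProduct.tmul_add, map_add, h₁, h₂]
      | tmul g h =>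
        change (Coalgebra.counit (R := k) g • a) ⊗ₜ[k] (Coalgebra.counit (R := k) b • h) =
          (Coalgebra.counit (R := k) b • a) ⊗ₜ[k] (Coalgebra.counit (R := k) g • h)
        rw [TensorProduct.smul_tmul_smul, TensorProduct.smul_tmul_smul, mul_comm]
  induction u with
  | zero => simp
  | add a b ha hb => rw [map_add, map_add, ha, hb]
  | tmul a h => rw [TensorProduct.comul_tmul, key]; simp

/-- Pairing the projections in the opposite order also recovers u, up to the flip. Combined with
multiplicativity of Δ, this is the source of both twisted cocommutativity conditions. -/
theorem map_snd_fst_comul (u : A ⊗[k] H) :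
    TensorProduct.map (tensorSnd k A H : A ⊗[k] H →ₗ[k] H) (tensorFst k A H : A ⊗[k] H →ₗ[k] A)
      (Coalgebra.comul (R := k) u) = TensorProduct.comm k A H u := by
  have key (s : A ⊗[k] A) (t : H ⊗[k] H) :
      TensorProduct.map (tensorSnd k A H : A ⊗[k] H →ₗ[k] H) (tensorFst k A H : A ⊗[k] H →ₗ[k] A)
        (TensorProduct.AlgebraTensorModule.tensorTensorTensorComm k k k k A A H H (s ⊗ₜ[k] t)) =
      TensorProduct.rid k H ((Coalgebra.counit (R := k) (A := H)).lTensor H t) ⊗ₜ[k]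
        TensorProduct.lid k A ((Coalgebra.counit (R := k) (A := A)).rTensor A s) := by
    induction s with
    | zero => simp
    | add s₁ s₂ h₁ h₂ => simp only [TensorProduct.add_tmul, TensorProduct.tmul_add, map_add, h₁, h₂]
    | tmul a b =>
      induction t with
      | zero => simp
      | add t₁ t₂ h₁ h₂ => simp only [TensorProduct.tmul_add, TensorProduct.add_tmul, map_add, h₁, h₂]
      | tmul g h =>
        change (Coalgebra.counit (R := k) a • g) ⊗ₜ[k] (Coalgebra.counit (R := k) h • b) =
          (Coalgebra.counit (R := k) h • g) ⊗ₜ[k] (Coalgebra.counit (R := k) a • b)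
        rw [TensorProduct.smul_tmul_smul, TensorProduct.smul_tmul_smul, mul_comm]
  induction u with
  | zero => simp
  | add a b ha hb => rw [map_add, map_add, ha, hb, map_add]
  | tmul a h => rw [TensorProduct.comul_tmul, key]; simp

theorem eq_tmul_of_isGroupLikeElem {u : A ⊗[k] H} (hu : IsGroupLikeElem k u) :
    u = tensorFst k A H u ⊗ₜ[k] tensorSnd k A H u := by
  conv_lhs => rw [← map_fst_snd_comul u, hu.comul_eq_tmul_self, TensorProduct.map_tmul]
  rfl

theorem comul_tensorFst (u : A ⊗[k] H) : Coalgebra.comul (R := k) (tensorFst k A H u) =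
    TensorProduct.map (tensorFst k A H : A ⊗[k] H →ₗ[k] A) (tensorFst k A H : A ⊗[k] H →ₗ[k] A)
      (Coalgebra.comul (R := k) u) :=
  (CoalgHomClass.map_comp_comul_apply (tensorFst k A H) u).symm

theorem comul_tensorSnd (u : A ⊗[k] H) : Coalgebra.comul (R := k) (tensorSnd k A H u) =
    TensorProduct.map (tensorSnd k A H : A ⊗[k] H →ₗ[k] H) (tensorSnd k A H : A ⊗[k] H →ₗ[k] H)
      (Coalgebra.comul (R := k) u) :=
  (CoalgHomClass.map_comp_comul_apply (tensorSnd k A H) u).symm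

/-- An element `u` of `A ⊗ H` with `Δ(u) = u ⊗ 1 + (1 ⊗ h) ⊗ u` is determined by its images in `A`
and `H`. -/
theorem skewPrimitive_tensor {u : A ⊗[k] H} {h : H} (hh : Coalgebra.counit (R := k) h = 1)
    (hu : Coalgebra.comul (R := k) u = u ⊗ₜ[k] 1 + (1 ⊗ₜ[k] h) ⊗ₜ[k] u) :
    u = tensorFst k A H u ⊗ₜ[k] 1 + 1 ⊗ₜ[k] tensorSnd k A H u ∧
      u = tensorFst k A H u ⊗ₜ[k] h + 1 ⊗ₜ[k] tensorSnd k A H u ∧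
      Coalgebra.comul (R := k) (tensorFst k A H u) =
        tensorFst k A H u ⊗ₜ[k] 1 + 1 ⊗ₜ[k] tensorFst k A H u ∧
      Coalgebra.comul (R := k) (tensorSnd k A H u) =
        tensorSnd k A H u ⊗ₜ[k] 1 + h ⊗ₜ[k] tensorSnd k A H u := by
  -- The first two equalities apply the two orders of pairing to the same Δ(u). Together they say v
  -- ⊗ 1 = v ⊗ h for the A-component v of u.
  refine ⟨?_, ?_, ?_, ?_⟩
  · conv_lhs => rw [← map_fst_snd_comul u, hu]
    simp [hh]
  · apply (TensorProduct.comm k A H).injective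
    rw [← map_snd_fst_comul u, hu]
    simp [add_comm]
  · rw [comul_tensorFst, hu]
    simp [hh]
  · rw [comul_tensorSnd, hu]
    simp

end TensorCoalgebra

/-! ### Group-like and primitive elements of `k⟨y | y ^ p = 0⟩ ⊗ H₄` -/

section PrimitiveElements

open Sweedler in
theorem eq_one_tmul_g {k : Type*} [Field k] {p : ℕ} [Fact p.Prime] [CharP k p]
    {u : TruncPoly k p ⊗[k] Sweedler k} (hu : IsGroupLikeElem k u) (h1 : u ≠ 1) :
    u = 1 ⊗ₜ[k] g k := by
  have h := eq_tmul_of_isGroupLikeElem hu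
  rw [TruncPoly.eq_one_of_isGroupLikeElem (hu.map (tensorFst k _ _))] at h
  rcases eq_one_or_eq_g (hu.map (tensorSnd k _ _)) with h' | h'
  · rw [h'] at h
    exact absurd h h1
  · rwa [h'] at h

variable {k : Type*} [Field k] {p : ℕ} [Fact p.Prime] [CharP k p]
  {u : TruncPoly k p ⊗[k] Sweedler k}

theorem exists_eq_smul_y_tmul_one (hu : Coalgebra.comul (R := k) u = u ⊗ₜ[k] 1 + 1 ⊗ₜ[k] u) :
    ∃ c : k, u = (c • TruncPoly.y k p) ⊗ₜ[k] 1 := by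
  obtain ⟨h1, -, h2, h3⟩ := skewPrimitive_tensor (u := u) (h := 1) (by simp) hu
  obtain ⟨c, hc⟩ := TruncPoly.exists_eq_smul_y h2
  rw [Sweedler.eq_zero_of_primitive h3, hc, TensorProduct.tmul_zero, add_zero] at h1
  exact ⟨c, h1⟩

theorem exists_eq_one_tmul (hu : Coalgebra.comul (R := k) u =
    u ⊗ₜ[k] 1 + (1 ⊗ₜ[k] Sweedler.g k) ⊗ₜ[k] u) :
    ∃ a c : k, u = 1 ⊗ₜ[k] (a • (1 - Sweedler.g k) + c • Sweedler.x k) := by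
  obtain ⟨h1, h2, -, h3⟩ := skewPrimitive_tensor (u := u) (Sweedler.counit_g k) hu
  obtain ⟨a, c, hc⟩ := Sweedler.exists_eq_of_skewPrimitive h3
  -- For the A-component v of u, v ⊗ 1 = v ⊗ g, and independence of 1 and g gives v = 0.
  have h0 := (Sweedler.tmul_inj (v₀ := tensorFst k _ _ u) (v₁ := 0) (v₂ := 0) (v₃ := 0) (w₀ := 0)
    (w₁ := tensorFst k _ _ u) (w₂ := 0) (w₃ := 0)
    (by simpa using add_right_cancel (h1.symm.trans h2))).1
  rw [h0, hc, TensorProduct.zero_tmul, zero_add] at h1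
  exact ⟨a, c, h1⟩

end PrimitiveElements


/-! ### Consequences of the crossed system axioms: coalgebra maps and twisted cocommutativity -/

section CrossedLemmas

variable {k A H : Type*} [Field k] [Ring A] [Ring H] [HopfAlgebra k A] [HopfAlgebra k H]
  {act : H →ₗ[k] A →ₗ[k] A} {f : H ⊗[k] H →ₗ[k] A}

theorem crossedLeftMul_tmul (a : A) (u : A ⊗[k] H) :
    crossedLeftMul k A H (a ⊗ₜ[k] u) = (a ⊗ₜ[k] 1) * u := by
  induction u with
  | zero => simp
  | add u v hu hv => rw [TensorProduct.tmul_add, map_add, hu, hv, mul_add]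
  | tmul b h => simp [crossedLeftMul]

/-- Isolates Δ(h), whose first leg acts on c and whose second leg enters the cocycle, so that facts
about `act.flip c` can be used before Δ(h) is expanded. -/
theorem crossedMul_tmul_tmul (act : H →ₗ[k] A →ₗ[k] A) (f : H ⊗[k] H →ₗ[k] A) (a c : A) (h g : H) :
    crossedMul act f ((a ⊗ₜ[k] h) ⊗ₜ[k] (c ⊗ₜ[k] g)) =
      (a ⊗ₜ[k] 1) * crossedLeftMul k A H (TensorProduct.map (act.flip c)
        (crossedCocycleMul f ∘ₗ (TensorProduct.mk k H H).flip g) (Coalgebra.comul (R := k) h)) := by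
  simp only [crossedMul, LinearMap.comp_apply, LinearEquiv.coe_coe, TensorProduct.assoc_tmul,
    LinearMap.lTensor_tmul, LinearMap.rTensor_tmul]
  rw [crossedLeftMul_tmul]
  congr 2
  generalize Coalgebra.comul (R := k) h = s
  induction s with
  | zero => simp
  | add s t hs ht => rw [TensorProduct.add_tmul, map_add, map_add, map_add, hs, ht]
  | tmul s t => simp

/-- The counit axiom for maps c ↦ ε(c)v, the shape taken below by trivial actions, trivial cocycles
and trivial cocentral maps. -/
theorem TensorProduct.map_counit_comul {k C V W : Type*} [Field k] [AddCommGroup C] [Module k C]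
    [Coalgebra k C] [AddCommGroup V] [Module k V] [AddCommGroup W] [Module k W] (v : V)
    (φ : C →ₗ[k] W) (c : C) :
    TensorProduct.map ((Coalgebra.counit (R := k) (A := C)).smulRight v) φ
      (Coalgebra.comul (R := k) c) = v ⊗ₜ[k] φ c := by
  have h := congrArg (TensorProduct.map (LinearMap.toSpanSingleton k V v) φ)
    (Coalgebra.rTensor_counit_comul (R := k) c)
  rw [LinearMap.rTensor, ← LinearMap.comp_apply, ← TensorProduct.map_comp] at h
  have e : (Coalgebra.counit (R := k) (A := C)).smulRight v =
      LinearMap.toSpanSingleton k V v ∘ₗ Coalgebra.counit (R := k) (A := C) := by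
    ext
    simp
  rw [e]
  simpa [LinearMap.comp_id] using h

theorem TensorProduct.map_comul_counit {k C V W : Type*} [Field k] [AddCommGroup C] [Module k C]
    [Coalgebra k C] [AddCommGroup V] [Module k V] [AddCommGroup W] [Module k W] (v : V)
    (φ : C →ₗ[k] W) (c : C) :
    TensorProduct.map φ ((Coalgebra.counit (R := k) (A := C)).smulRight v)
      (Coalgebra.comul (R := k) c) = φ c ⊗ₜ[k] v := by
  have h := congrArg (TensorProduct.map φ (LinearMap.toSpanSingleton k V v))
    (Coalgebra.lTensor_counit_comul (R := k) c)
  rw [LinearMap.lTensor, ← LinearMap.comp_apply, ← TensorProduct.map_comp] at h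
  have e : (Coalgebra.counit (R := k) (A := C)).smulRight v =
      LinearMap.toSpanSingleton k V v ∘ₗ Coalgebra.counit (R := k) (A := C) := by
    ext
    simp
  rw [e]
  simpa [LinearMap.comp_id] using h

/-- Because h ▷ 1 = ε(h)1, the action drops out; facts about the cocycle can thus be read off from
products in A # H. -/
theorem IsWeakAction.crossedMul_one_one (hw : IsWeakAction act) (h g : H) :
    crossedMul act f ((1 ⊗ₜ[k] h) ⊗ₜ[k] (1 ⊗ₜ[k] g)) = crossedCocycleMul f (h ⊗ₜ[k] g) := by
  have e : act.flip 1 = (Coalgebra.counit (R := k) (A := H)).smulRight (1 : A) :=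
    LinearMap.ext hw.act_one
  rw [crossedMul_tmul_tmul, e, TensorProduct.map_counit_comul, crossedLeftMul_tmul,
    ← Algebra.TensorProduct.one_def, one_mul, one_mul]
  rfl

theorem tensorFst_crossedCocycleMul (f : H ⊗[k] H →ₗ[k] A) (w : H ⊗[k] H) :
    tensorFst k A H (crossedCocycleMul f w) = f w := by
  have e (u : A ⊗[k] H) : tensorFst k A H u =
      TensorProduct.rid k A ((Coalgebra.counit (R := k) (A := H)).lTensor A u) := rfl
  have e2 : Coalgebra.counit (R := k) (A := H) ∘ₗ LinearMap.mul' k H =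
      (Coalgebra.counit (R := k) (A := H ⊗[k] H)).smulRight (1 : k) := by
    ext a b
    simp [mul_comm]
  rw [e, crossedCocycleMul, LinearMap.lTensor, LinearMap.comp_apply, ← LinearMap.comp_apply,
    ← TensorProduct.map_comp, e2, TensorProduct.map_comul_counit]
  simp

namespace IsCrossedSystem

variable (hS : IsCrossedSystem act f)
include hS

theorem cocycleMul_one_left (h : H) : crossedCocycleMul f (1 ⊗ₜ[k] h) = 1 ⊗ₜ[k] h := by
  rw [← hS.weakAction.crossedMul_one_one, hS.one_mul]

theorem cocycleMul_one_right (h : H) : crossedCocycleMul f (h ⊗ₜ[k] 1) = 1 ⊗ₜ[k] h := by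
  rw [← hS.weakAction.crossedMul_one_one, hS.mul_one]

theorem counit_cocycle (w : H ⊗[k] H) :
    Coalgebra.counit (R := k) (f w) = Coalgebra.counit (R := k) w := by
  induction w with
  | zero => simp
  | add u v hu hv => rw [map_add, map_add, map_add, hu, hv]
  | tmul h g =>
    rw [← tensorFst_crossedCocycleMul, CoalgHomClass.counit_comp_apply,
      ← hS.weakAction.crossedMul_one_one, hS.counit_mul]
    simp [mul_comm]

theorem tensorSnd_cocycleMul (w : H ⊗[k] H) :
    tensorSnd k A H (crossedCocycleMul f w) = LinearMap.mul' k H w := by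
  have e (u : A ⊗[k] H) : tensorSnd k A H u =
      TensorProduct.lid k H ((Coalgebra.counit (R := k) (A := A)).rTensor H u) := rfl
  have e2 : Coalgebra.counit (R := k) (A := A) ∘ₗ f =
      (Coalgebra.counit (R := k) (A := H ⊗[k] H)).smulRight (1 : k) :=
    LinearMap.ext fun w => by simp [hS.counit_cocycle]
  rw [e, crossedCocycleMul, LinearMap.rTensor, LinearMap.comp_apply, ← LinearMap.comp_apply,
    ← TensorProduct.map_comp, e2, TensorProduct.map_counit_comul]
  simp

/-- This is multiplicativity of Δ on 1 # h and 1 # g, whose product involves only the cocycle. -/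
theorem comul_cocycleMul (w : H ⊗[k] H) : Coalgebra.comul (R := k) (crossedCocycleMul f w) =
    TensorProduct.map (crossedCocycleMul f) (crossedCocycleMul f) (Coalgebra.comul (R := k) w) := by
  have key (s t : H ⊗[k] H) :
      TensorProduct.map (crossedMul act f) (crossedMul act f)
        (TensorProduct.tensorTensorTensorComm k (A ⊗[k] H) (A ⊗[k] H) (A ⊗[k] H) (A ⊗[k] H)
          (AlgebraTensorModule.tensorTensorTensorComm k k k k A A H H
            (((1 : A) ⊗ₜ[k] (1 : A)) ⊗ₜ[k] s) ⊗ₜ[k]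
          AlgebraTensorModule.tensorTensorTensorComm k k k k A A H H
            (((1 : A) ⊗ₜ[k] (1 : A)) ⊗ₜ[k] t))) =
      TensorProduct.map (crossedCocycleMul f) (crossedCocycleMul f)
        (AlgebraTensorModule.tensorTensorTensorComm k k k k H H H H (s ⊗ₜ[k] t)) := by
    induction s with
    | zero => simp
    | add s₁ s₂ h₁ h₂ => simp only [TensorProduct.add_tmul, TensorProduct.tmul_add, map_add, h₁, h₂]
    | tmul a b =>
      induction t with
      | zero => simp
      | add t₁ t₂ h₁ h₂ => simp only [TensorProduct.tmul_add, map_add, h₁, h₂]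
      | tmul c d => simp [hS.weakAction.crossedMul_one_one]
  induction w with
  | zero => simp
  | add u v hu hv => simp only [map_add, hu, hv]
  | tmul h g =>
    rw [← hS.weakAction.crossedMul_one_one, hS.comul_mul, TensorProduct.comul_tmul,
      TensorProduct.comul_tmul, TensorProduct.comul_tmul, Bialgebra.comul_one,
      Algebra.TensorProduct.one_def]
    exact key _ _

/-- The cocycle is a coalgebra map. -/
theorem comul_cocycle (w : H ⊗[k] H) : Coalgebra.comul (R := k) (f w) =
    TensorProduct.map f f (Coalgebra.comul (R := k) w) := by
  have e : (tensorFst k A H : A ⊗[k] H →ₗ[k] A) ∘ₗ crossedCocycleMul f = f :=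
    LinearMap.ext (tensorFst_crossedCocycleMul f)
  rw [← tensorFst_crossedCocycleMul, comul_tensorFst, hS.comul_cocycleMul, ← LinearMap.comp_apply,
    ← TensorProduct.map_comp, e]

/-- The twisted cocommutativity of the cocycle: `f(h₁, g₁) ⊗ h₂ g₂ = f(h₂, g₂) ⊗ h₁ g₁`. -/
theorem comm_cocycleMul (w : H ⊗[k] H) :
    TensorProduct.comm k A H (crossedCocycleMul f w) =
      TensorProduct.map (LinearMap.mul' k H) f (Coalgebra.comul (R := k) w) := by
  have e : (tensorFst k A H : A ⊗[k] H →ₗ[k] A) ∘ₗ crossedCocycleMul f = f :=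
    LinearMap.ext (tensorFst_crossedCocycleMul f)
  have e' : (tensorSnd k A H : A ⊗[k] H →ₗ[k] H) ∘ₗ crossedCocycleMul f = LinearMap.mul' k H :=
    LinearMap.ext hS.tensorSnd_cocycleMul
  -- `crossedCocycleMul f` respects Δ and has components f and the multiplication of H, so pairing
  -- its projections in the opposite order exchanges the two components.
  rw [← map_snd_fst_comul, hS.comul_cocycleMul, ← LinearMap.comp_apply,
    ← TensorProduct.map_comp, e, e']

theorem crossedMul_tmul_one (h : H) (c : A) :
    crossedMul act f ((1 ⊗ₜ[k] h) ⊗ₜ[k] (c ⊗ₜ[k] 1)) =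
      (act.flip c).rTensor H (Coalgebra.comul (R := k) h) := by
  rw [crossedMul_tmul_tmul, ← Algebra.TensorProduct.one_def, _root_.one_mul]
  generalize Coalgebra.comul (R := k) h = s
  induction s with
  | zero => simp
  | add s t hs ht => rw [map_add, map_add, map_add, hs, ht]
  | tmul s t => simp [crossedLeftMul_tmul, hS.cocycleMul_one_right]

theorem tensorFst_crossedMul_tmul_one (h : H) (c : A) :
    tensorFst k A H (crossedMul act f ((1 ⊗ₜ[k] h) ⊗ₜ[k] (c ⊗ₜ[k] 1))) = act h c := by
  have e (u : A ⊗[k] H) : tensorFst k A H u =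
      TensorProduct.rid k A ((Coalgebra.counit (R := k) (A := H)).lTensor A u) := rfl
  rw [hS.crossedMul_tmul_one, e, LinearMap.rTensor, LinearMap.lTensor, ← LinearMap.comp_apply,
    ← TensorProduct.map_comp]
  have h2 := TensorProduct.map_comul_counit (1 : k) (act.flip c) h
  have e2 : (Coalgebra.counit (R := k) (A := H)).smulRight (1 : k) =
    Coalgebra.counit (R := k) (A := H) := by ext; simp
  rw [e2] at h2
  rw [LinearMap.id_comp, LinearMap.comp_id, h2]
  simp

theorem counit_act (h : H) (c : A) : Coalgebra.counit (R := k) (act h c) =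
    Coalgebra.counit (R := k) h * Coalgebra.counit (R := k) c := by
  rw [← hS.tensorFst_crossedMul_tmul_one, CoalgHomClass.counit_comp_apply, hS.counit_mul]
  simp

theorem tensorSnd_crossedMul_tmul_one (h : H) (c : A) :
    tensorSnd k A H (crossedMul act f ((1 ⊗ₜ[k] h) ⊗ₜ[k] (c ⊗ₜ[k] 1))) =
      Coalgebra.counit (R := k) c • h := by
  have e (u : A ⊗[k] H) : tensorSnd k A H u =
      TensorProduct.lid k H ((Coalgebra.counit (R := k) (A := A)).rTensor H u) := rfl
  have e2 : Coalgebra.counit (R := k) (A := A) ∘ₗ act.flip c =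
      (Coalgebra.counit (R := k) (A := H)).smulRight (Coalgebra.counit (R := k) c) := by
    ext h
    simp [hS.counit_act]
  rw [hS.crossedMul_tmul_one, e, LinearMap.rTensor, LinearMap.rTensor, ← LinearMap.comp_apply,
    ← TensorProduct.map_comp, e2, LinearMap.id_comp, TensorProduct.map_counit_comul]
  simp

/-- The twisted cocommutativity of the weak action: `h₁ ⊗ h₂ ▷ c = h₂ ⊗ h₁ ▷ c`. -/
theorem comm_act (h : H) (c : A) :
    TensorProduct.comm k A H ((act.flip c).rTensor H (Coalgebra.comul (R := k) h)) =
      (act.flip c).lTensor H (Coalgebra.comul (R := k) h) := by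
  -- In Δ(1 # h)Δ(c # 1), the first leg projected to H is h₁ε(c₁) and the second projected to A is
  -- h₂ ▷ c₂. The claim is stated for arbitrary s and t in place of Δ(h) and Δ(c) to allow
  -- induction.
  have key (s : H ⊗[k] H) (t : A ⊗[k] A) :
      TensorProduct.map (tensorSnd k A H : A ⊗[k] H →ₗ[k] H) (tensorFst k A H : A ⊗[k] H →ₗ[k] A)
      (TensorProduct.map (crossedMul act f) (crossedMul act f)
        (TensorProduct.tensorTensorTensorComm k (A ⊗[k] H) (A ⊗[k] H) (A ⊗[k] H) (A ⊗[k] H)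
          (AlgebraTensorModule.tensorTensorTensorComm k k k k A A H H
            (((1 : A) ⊗ₜ[k] (1 : A)) ⊗ₜ[k] s) ⊗ₜ[k]
          AlgebraTensorModule.tensorTensorTensorComm k k k k A A H H
            (t ⊗ₜ[k] ((1 : H) ⊗ₜ[k] (1 : H)))))) =
      (act.flip (TensorProduct.lid k A
        ((Coalgebra.counit (R := k) (A := A)).rTensor A t))).lTensor H s := by
    induction s with
    | zero => simp
    | add s₁ s₂ h₁ h₂ => simp only [TensorProduct.add_tmul, TensorProduct.tmul_add, map_add, h₁, h₂]
    | tmul a b =>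
      induction t with
      | zero => simp
      | add t₁ t₂ h₁ h₂ =>
        simp only [TensorProduct.add_tmul, TensorProduct.tmul_add, map_add, h₁, h₂,
          LinearMap.lTensor_add, LinearMap.add_apply]
      | tmul c d =>
        simp [hS.tensorSnd_crossedMul_tmul_one, hS.tensorFst_crossedMul_tmul_one,
          TensorProduct.smul_tmul]
  rw [← hS.crossedMul_tmul_one, ← map_snd_fst_comul, hS.comul_mul, TensorProduct.comul_tmul,
      TensorProduct.comul_tmul, Bialgebra.comul_one, Bialgebra.comul_one,
      Algebra.TensorProduct.one_def, Algebra.TensorProduct.one_def]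
  refine (key _ _).trans ?_
  simp

end IsCrossedSystem

end CrossedLemmas


/-! ### Crossed systems for H₄: trivial action and a one-parameter family of cocycles -/

/-- The trivial weak action `h ▷ a = ε(h) a`. -/
def trivialAct (k A H : Type*) [Field k] [Ring A] [Ring H] [HopfAlgebra k A] [HopfAlgebra k H] :
    H →ₗ[k] A →ₗ[k] A :=
  (Coalgebra.counit (R := k) (A := H)).smulRight LinearMap.id

@[simp]
theorem trivialAct_apply {k A H : Type*} [Field k] [Ring A] [Ring H] [HopfAlgebra k A]
    [HopfAlgebra k H] (h : H) (a : A) :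
    trivialAct k A H h a = Coalgebra.counit (R := k) h • a := rfl

theorem isWeakAction_trivialAct {k A H : Type*} [Field k] [Ring A] [Ring H] [HopfAlgebra k A]
    [HopfAlgebra k H] : IsWeakAction (trivialAct k A H) where
  act_one _ := rfl
  one_act _ := by simp
  act_mul h a b := by
    have e (c : A) : (trivialAct k A H).flip c =
      (Coalgebra.counit (R := k) (A := H)).smulRight c := rfl
    rw [e, e, TensorProduct.map_counit_comul]
    simp

namespace Sweedler

variable (k : Type*) [Field k]

/-- The bilinear form on `H₄` with matrix `1, -1; 1, -1` on `x, g x`, and zero on the other basis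
vectors. -/
def skewForm : Sweedler k ⊗[k] Sweedler k →ₗ[k] k :=
  LinearMap.mul' k k ∘ₗ TensorProduct.map ((basis k).coord 2 + (basis k).coord 3)
    ((basis k).coord 2 - (basis k).coord 3)

/-- The cocycle `H₄ ⊗ H₄ → k⟨y | y ^ p = 0⟩` with `f(x, x) = l y`. -/
def cocycle (p : ℕ) (l : k) : Sweedler k ⊗[k] Sweedler k →ₗ[k] TruncPoly k p :=
  (Coalgebra.counit (R := k) (A := Sweedler k ⊗[k] Sweedler k)).smulRight 1 +
    (skewForm k).smulRight (l • TruncPoly.y k p)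

theorem cocycle_tmul (p : ℕ) (l : k) (h g : Sweedler k) : cocycle k p l (h ⊗ₜ[k] g) =
    (Coalgebra.counit (R := k) g * Coalgebra.counit (R := k) h) • 1 +
      (((basis k).coord 2 h + (basis k).coord 3 h) *
        ((basis k).coord 2 g - (basis k).coord 3 g)) • (l • TruncPoly.y k p) :=
  rfl

variable {k} {p : ℕ} [Fact p.Prime] [CharP k p]
  {act : Sweedler k →ₗ[k] TruncPoly k p →ₗ[k] TruncPoly k p}
  {f : Sweedler k ⊗[k] Sweedler k →ₗ[k] TruncPoly k p}

/-- At x, twisted cocommutativity compares (x▷c) ⊗ 1 + (g▷c) ⊗ x with c ⊗ x + (x▷c) ⊗ g. At gx, once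
g▷c = c is known, it compares (gx▷c) ⊗ g + c ⊗ gx with (gx▷c) ⊗ 1 + c ⊗ gx. -/
theorem act_eq_trivialAct (hS : IsCrossedSystem act f) :
    act = trivialAct k (TruncPoly k p) (Sweedler k) := by
  have hx (c : TruncPoly k p) : c = act (g k) c ∧ act (x k) c = 0 := by
    have h := congrArg (TensorProduct.comm k _ _) (hS.comm_act (x k) c)
    simp only [comul_x, map_add, LinearMap.rTensor_tmul, LinearMap.lTensor_tmul,
      TensorProduct.comm_tmul, LinearMap.flip_apply, hS.weakAction.one_act] at h
    have h' := tmul_inj (v₀ := act (x k) c) (v₁ := 0) (v₂ := act (g k) c) (v₃ := 0) (w₀ := 0)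
      (w₁ := act (x k) c) (w₂ := c) (w₃ := 0) (by simpa [add_comm] using h)
    exact ⟨h'.2.2.1.symm, h'.1⟩
  have hgx (c : TruncPoly k p) : act (g k * x k) c = 0 := by
    have h := congrArg (TensorProduct.comm k _ _) (hS.comm_act (g k * x k) c)
    simp only [comul_gx, map_add, LinearMap.rTensor_tmul, LinearMap.lTensor_tmul,
      TensorProduct.comm_tmul, LinearMap.flip_apply, hS.weakAction.one_act, ← (hx c).1] at h
    have h' := tmul_inj (v₀ := 0) (v₁ := act (g k * x k) c) (v₂ := 0) (v₃ := c)
      (w₀ := act (g k * x k) c) (w₁ := 0) (w₂ := 0) (w₃ := c) (by simpa [add_comm] using h)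
    exact h'.2.1
  refine linearMap_ext ?_ ?_ ?_ ?_ <;> refine LinearMap.ext fun c => ?_
  · simpa using hS.weakAction.one_act c
  · simpa using (hx c).1.symm
  · simpa using (hx c).2
  · simpa [counit_gx] using hgx c

/-- At (g,x), twisted cocommutativity compares f(g,x) ⊗ g + f(g,g) ⊗ gx with f(g,x) ⊗ 1 + 1 ⊗ gx.
The other pairs are treated alike, using f(g,g) = 1. -/
theorem cocycle_values (hS : IsCrossedSystem act f) :
    f (g k ⊗ₜ[k] g k) = 1 ∧ f (g k ⊗ₜ[k] x k) = 0 ∧ f (x k ⊗ₜ[k] g k) = 0 ∧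
      f (g k ⊗ₜ[k] (g k * x k)) = 0 ∧ f ((g k * x k) ⊗ₜ[k] g k) = 0 := by
  have hl (h : Sweedler k) : f (1 ⊗ₜ[k] h) = Coalgebra.counit (R := k) h • 1 := by
    rw [← tensorFst_crossedCocycleMul, hS.cocycleMul_one_left, tensorFst_tmul]
  have hr (h : Sweedler k) : f (h ⊗ₜ[k] 1) = Coalgebra.counit (R := k) h • 1 := by
    rw [← tensorFst_crossedCocycleMul, hS.cocycleMul_one_right, tensorFst_tmul]
  have H (w : Sweedler k ⊗[k] Sweedler k) : crossedCocycleMul f w = _ :=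
    (LinearEquiv.eq_symm_apply (TensorProduct.comm k _ _)).2 (hS.comm_cocycleMul w)
  have h1 := H (g k ⊗ₜ[k] x k)
  have h2 := H (x k ⊗ₜ[k] g k)
  have h3 := H (g k ⊗ₜ[k] (g k * x k))
  have h4 := H ((g k * x k) ⊗ₜ[k] g k)
  simp only [crossedCocycleMul, LinearMap.comp_apply, TensorProduct.comul_tmul, comul_g, comul_x,
    comul_gx, TensorProduct.tmul_add, TensorProduct.add_tmul, map_add,
    AlgebraTensorModule.tensorTensorTensorComm_tmul, TensorProduct.map_tmul, LinearMap.mul'_apply,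
    TensorProduct.comm_symm_tmul, hl, hr, mul_one, one_mul, counit_g,
    g_mul_g, x_mul_g, g_mul_gx, gx_mul_g, one_smul, TensorProduct.tmul_neg] at h1 h2 h3 h4
  have e1 := tmul_inj (v₀ := 0) (v₁ := f (g k ⊗ₜ[k] x k)) (v₂ := 0) (v₃ := f (g k ⊗ₜ[k] g k))
    (w₀ := f (g k ⊗ₜ[k] x k)) (w₁ := 0) (w₂ := 0) (w₃ := 1) (by simpa [add_comm] using h1)
  rw [e1.2.2.2] at h2 h3 h4
  have e2 := tmul_inj (v₀ := 0) (v₁ := f (x k ⊗ₜ[k] g k)) (v₂ := 0) (v₃ := -1)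
    (w₀ := f (x k ⊗ₜ[k] g k)) (w₁ := 0) (w₂ := 0) (w₃ := -1)
    (by simpa [add_comm, TensorProduct.neg_tmul] using h2)
  have e3 := tmul_inj (v₀ := f (g k ⊗ₜ[k] (g k * x k))) (v₁ := 0) (v₂ := 1) (v₃ := 0)
    (w₀ := 0) (w₁ := f (g k ⊗ₜ[k] (g k * x k))) (w₂ := 1) (w₃ := 0)
    (by simpa [add_comm] using h3)
  have e4 := tmul_inj (v₀ := f ((g k * x k) ⊗ₜ[k] g k)) (v₁ := 0) (v₂ := -1) (v₃ := 0)
    (w₀ := 0) (w₁ := f ((g k * x k) ⊗ₜ[k] g k)) (w₂ := -1) (w₃ := 0)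
    (by simpa [add_comm, TensorProduct.neg_tmul] using h4)
  exact ⟨e1.2.2.2, e1.2.1, e2.2.1, e3.1, e4.1⟩

/-- Since f is a coalgebra map with known values on pairs from {1, g, x} other than (x,x), s =
f(x,x) is primitive. Associativity on (g,x,x), (x,g,x) and (g,x,gx) then gives f(gx,x) = s, f(x,gx)
= -s and f(gx,gx) = -s. -/
theorem exists_eq_cocycle (hS : IsCrossedSystem act f) : ∃ l : k, f = cocycle k p l := by
  have hl (h : Sweedler k) : f (1 ⊗ₜ[k] h) = Coalgebra.counit (R := k) h • 1 := by
    rw [← tensorFst_crossedCocycleMul, hS.cocycleMul_one_left, tensorFst_tmul]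
  have hr (h : Sweedler k) : f (h ⊗ₜ[k] 1) = Coalgebra.counit (R := k) h • 1 := by
    rw [← tensorFst_crossedCocycleMul, hS.cocycleMul_one_right, tensorFst_tmul]
  obtain ⟨fgg, fgx, fxg, fggx, fgxg⟩ := cocycle_values hS
  have hprim : Coalgebra.comul (R := k) (f (x k ⊗ₜ[k] x k)) =
      f (x k ⊗ₜ[k] x k) ⊗ₜ[k] 1 + 1 ⊗ₜ[k] f (x k ⊗ₜ[k] x k) := by
    rw [hS.comul_cocycle]
    simp [TensorProduct.tmul_add, TensorProduct.add_tmul, hl, hr, fgg, fgx, fxg]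
  obtain ⟨l, hxx⟩ := TruncPoly.exists_eq_smul_y hprim
  set s := l • TruncPoly.y k p with hs
  have Fgx : crossedCocycleMul f (g k ⊗ₜ[k] x k) = 1 ⊗ₜ[k] (g k * x k) := by
    simp [crossedCocycleMul, TensorProduct.tmul_add, fgg, fgx]
  have Fxg : crossedCocycleMul f (x k ⊗ₜ[k] g k) = -(1 ⊗ₜ[k] (g k * x k)) := by
    simp [crossedCocycleMul, TensorProduct.add_tmul, fgg, fxg, x_mul_g, TensorProduct.tmul_neg]
  have Fxx : crossedCocycleMul f (x k ⊗ₜ[k] x k) = s ⊗ₜ[k] 1 := by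
    simp [crossedCocycleMul, TensorProduct.tmul_add, TensorProduct.add_tmul, fgg, fxg, fgx, hxx,
      x_mul_x]
  have Fgxx : crossedCocycleMul f ((g k * x k) ⊗ₜ[k] x k) =
      f ((g k * x k) ⊗ₜ[k] x k) ⊗ₜ[k] g k := by
    simp [crossedCocycleMul, comul_gx, -Bialgebra.comul_mul, TensorProduct.tmul_add, TensorProduct.add_tmul, fgxg, hl,
      gx_mul_x]
  have Fxgx : crossedCocycleMul f (x k ⊗ₜ[k] (g k * x k)) =
      f (x k ⊗ₜ[k] (g k * x k)) ⊗ₜ[k] g k := by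
    simp [crossedCocycleMul, comul_gx, -Bialgebra.comul_mul, TensorProduct.tmul_add, TensorProduct.add_tmul, fggx, hr,
      x_mul_gx]
  have Fgxgx : crossedCocycleMul f ((g k * x k) ⊗ₜ[k] (g k * x k)) =
      f ((g k * x k) ⊗ₜ[k] (g k * x k)) ⊗ₜ[k] 1 := by
    simp [crossedCocycleMul, comul_gx, -Bialgebra.comul_mul, TensorProduct.tmul_add, TensorProduct.add_tmul, hl, hr,
      gx_mul_gx, g_mul_g]
  -- As the action is trivial, coefficients in A pass through left multiplication by 1 # g.
  have mg (c : TruncPoly k p) (h : Sweedler k) :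
      crossedMul act f ((1 ⊗ₜ[k] g k) ⊗ₜ[k] (c ⊗ₜ[k] h)) =
        (c ⊗ₜ[k] 1) * crossedCocycleMul f (g k ⊗ₜ[k] h) := by
    rw [crossedMul_tmul_tmul, act_eq_trivialAct hS, ← Algebra.TensorProduct.one_def, one_mul]
    simp [crossedLeftMul_tmul]
  have Fg1 := hS.cocycleMul_one_right (g k)
  have Fgg : crossedCocycleMul f (g k ⊗ₜ[k] g k) = 1 ⊗ₜ[k] 1 := by
    simp [crossedCocycleMul, fgg, g_mul_g]
  have m1 := hS.weakAction.crossedMul_one_one (f := f)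
  have egxx : f ((g k * x k) ⊗ₜ[k] x k) = s := by
    have h := hS.mul_assoc (1 ⊗ₜ[k] g k) (1 ⊗ₜ[k] x k) (1 ⊗ₜ[k] x k)
    rw [m1, Fgx, m1, Fgxx, m1, Fxx, mg, Fg1, Algebra.TensorProduct.tmul_mul_tmul, mul_one,
      one_mul] at h
    exact (tmul_inj (v₀ := 0) (v₂ := 0) (v₃ := 0) (w₀ := 0) (w₂ := 0) (w₃ := 0)
      (by simpa using h)).2.1
  have exgx : f (x k ⊗ₜ[k] (g k * x k)) = -s := by
    have h := hS.mul_assoc (1 ⊗ₜ[k] x k) (1 ⊗ₜ[k] g k) (1 ⊗ₜ[k] x k)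
    rw [m1, Fxg, TensorProduct.neg_tmul, map_neg, m1, Fgxx, m1, Fgx, m1, Fxgx, egxx,
      ← TensorProduct.neg_tmul] at h
    exact (tmul_inj (v₀ := 0) (v₂ := 0) (v₃ := 0) (w₀ := 0) (w₂ := 0) (w₃ := 0)
      (by simpa using h.symm)).2.1
  have egxgx : f ((g k * x k) ⊗ₜ[k] (g k * x k)) = -s := by
    have h := hS.mul_assoc (1 ⊗ₜ[k] g k) (1 ⊗ₜ[k] x k) (1 ⊗ₜ[k] (g k * x k))
    rw [m1, Fgx, m1, Fgxgx, m1, Fxgx, exgx, mg, Fgg, Algebra.TensorProduct.tmul_mul_tmul, mul_one,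
      one_mul] at h
    exact (tmul_inj (v₁ := 0) (v₂ := 0) (v₃ := 0) (w₁ := 0) (w₂ := 0) (w₃ := 0)
      (by simpa using h)).1
  refine ⟨l, TensorProduct.ext (linearMap_ext ?_ ?_ ?_ ?_)⟩ <;>
  refine linearMap_ext ?_ ?_ ?_ ?_ <;>
  simp [-Module.Basis.coord_apply, cocycle_tmul, hl, hr, fgg, fgx, fxg, fggx, fgxg, egxx, exgx, egxgx, hxx, coord_one,
    coord_g, coord_x, coord_gx, ← hs]

end Sweedler


/-! ### Crossed systems by transport of structure -/

section Transport

variable {k A H E : Type*} [Field k] [Ring A] [Ring H] [Ring E] [HopfAlgebra k A] [HopfAlgebra k H]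
  [HopfAlgebra k E] {act : H →ₗ[k] A →ₗ[k] A} {f : H ⊗[k] H →ₗ[k] A}

theorem comul_coalgEquiv {k C D : Type*} [Field k] [AddCommGroup C] [Module k C] [Coalgebra k C]
    [AddCommGroup D] [Module k D] [Coalgebra k D] (e : C ≃ₗc[k] D) (c : C) :
    TensorProduct.map e.toLinearEquiv.toLinearMap e.toLinearEquiv.toLinearMap
      (Coalgebra.comul (R := k) c) = Coalgebra.comul (R := k) (e c) :=
  CoalgHomClass.map_comp_comul_apply e c

/-- A weak action and a cocycle for which `A ⊗ H` is isomorphic, as a coalgebra with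
multiplication and unit, to a Hopf algebra form a crossed system. -/
theorem IsWeakAction.isCrossedSystem (hw : IsWeakAction act) (e : (A ⊗[k] H) ≃ₗc[k] E)
    (h1 : e (1 ⊗ₜ[k] 1) = 1) (hm : ∀ u v, e (crossedMul act f (u ⊗ₜ[k] v)) = e u * e v) :
    IsCrossedSystem act f where
  weakAction := hw
  mul_assoc x y z := EquivLike.injective e (by rw [hm, hm, hm, hm, mul_assoc])
  one_mul x := EquivLike.injective e (by rw [hm, h1, one_mul])
  mul_one x := EquivLike.injective e (by rw [hm, h1, mul_one])
  counit_mul x y := by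
    rw [← CoalgHomClass.counit_comp_apply e, hm, Bialgebra.counit_mul,
      CoalgHomClass.counit_comp_apply, CoalgHomClass.counit_comp_apply]
  comul_mul x y := by
    have key (s t : (A ⊗[k] H) ⊗[k] (A ⊗[k] H)) :
        TensorProduct.map e.toLinearEquiv.toLinearMap e.toLinearEquiv.toLinearMap
          (TensorProduct.map (crossedMul act f) (crossedMul act f)
            (TensorProduct.tensorTensorTensorComm k (A ⊗[k] H) (A ⊗[k] H) (A ⊗[k] H) (A ⊗[k] H)
              (s ⊗ₜ[k] t))) =
        TensorProduct.map e.toLinearEquiv.toLinearMap e.toLinearEquiv.toLinearMap s *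
          TensorProduct.map e.toLinearEquiv.toLinearMap e.toLinearEquiv.toLinearMap t := by
      induction s with
      | zero => simp
      | add s₁ s₂ h₁ h₂ => simp only [TensorProduct.add_tmul, map_add, h₁, h₂, add_mul]
      | tmul a b =>
        induction t with
        | zero => simp
        | add t₁ t₂ h₁ h₂ => simp only [TensorProduct.tmul_add, map_add, h₁, h₂, mul_add]
        | tmul c d => simp [hm]
    refine (TensorProduct.congr e.toLinearEquiv e.toLinearEquiv).injective ?_
    refine Eq.trans ?_ (key _ _).symm
    refine (comul_coalgEquiv e _).trans ?_
    rw [hm, Bialgebra.comul_mul, comul_coalgEquiv, comul_coalgEquiv]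
  exists_antipode := by
    refine ⟨e.symm.toLinearEquiv.toLinearMap ∘ₗ HopfAlgebra.antipode k ∘ₗ
      e.toLinearEquiv.toLinearMap, fun x => ⟨EquivLike.injective e ?_, EquivLike.injective e ?_⟩⟩
    · have key (s : (A ⊗[k] H) ⊗[k] (A ⊗[k] H)) :
          e (crossedMul act f ((e.symm.toLinearEquiv.toLinearMap ∘ₗ HopfAlgebra.antipode k ∘ₗ
            e.toLinearEquiv.toLinearMap).rTensor (A ⊗[k] H) s)) =
          LinearMap.mul' k E ((HopfAlgebra.antipode k).rTensor E
            (TensorProduct.map e.toLinearEquiv.toLinearMap e.toLinearEquiv.toLinearMap s)) := by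
        induction s with
        | zero => simp
        | add s₁ s₂ h₁ h₂ => simp only [map_add, h₁, h₂]
        | tmul a b =>
          simp only [LinearMap.rTensor_tmul, hm, TensorProduct.map_tmul, LinearMap.mul'_apply]
          congr 1
          exact e.apply_symm_apply _
      rw [key, comul_coalgEquiv, HopfAlgebra.mul_antipode_rTensor_comul_apply,
        CoalgHomClass.counit_comp_apply, map_smul, h1, Algebra.algebraMap_eq_smul_one]
    · have key (s : (A ⊗[k] H) ⊗[k] (A ⊗[k] H)) :
          e (crossedMul act f ((e.symm.toLinearEquiv.toLinearMap ∘ₗ HopfAlgebra.antipode k ∘ₗ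
            e.toLinearEquiv.toLinearMap).lTensor (A ⊗[k] H) s)) =
          LinearMap.mul' k E ((HopfAlgebra.antipode k).lTensor E
            (TensorProduct.map e.toLinearEquiv.toLinearMap e.toLinearEquiv.toLinearMap s)) := by
        induction s with
        | zero => simp
        | add s₁ s₂ h₁ h₂ => simp only [map_add, h₁, h₂]
        | tmul a b =>
          simp only [LinearMap.lTensor_tmul, hm, TensorProduct.map_tmul, LinearMap.mul'_apply]
          congr 1
          exact e.apply_symm_apply _
      rw [key, comul_coalgEquiv, HopfAlgebra.mul_antipode_lTensor_comul_apply,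
        CoalgHomClass.counit_comp_apply, map_smul, h1, Algebra.algebraMap_eq_smul_one]

/-- A multiplicative isomorphism of coalgebras from `A ⊗ H` to a bialgebra, as an isomorphism of
bialgebras from the crossed product. -/
def CrossedProduct.bialgEquiv (S : CrossedSystem k A H) (e : (A ⊗[k] H) ≃ₗc[k] E)
    (hm : ∀ u v, e (crossedMul S.act S.coc (u ⊗ₜ[k] v)) = e u * e v) :
    CrossedProduct S ≃ₐc[k] E :=
  { toCoalgEquiv := show CrossedProduct S ≃ₗc[k] E from e
    map_mul' := hm }

theorem crossedMul_trivialAct (f : H ⊗[k] H →ₗ[k] A) (a c : A) (h g : H) :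
    crossedMul (trivialAct k A H) f ((a ⊗ₜ[k] h) ⊗ₜ[k] (c ⊗ₜ[k] g)) =
      ((a * c) ⊗ₜ[k] 1) * crossedCocycleMul f (h ⊗ₜ[k] g) := by
  have e : (trivialAct k A H).flip c = (Coalgebra.counit (R := k) (A := H)).smulRight c := rfl
  rw [crossedMul_tmul_tmul, e, TensorProduct.map_counit_comul, crossedLeftMul_tmul, ← mul_assoc,
    Algebra.TensorProduct.tmul_mul_tmul, mul_one]
  rfl

theorem crossedMul_trivial (u v : A ⊗[k] H) :
    crossedMul (trivialAct k A H)
      ((Coalgebra.counit (R := k) (A := H ⊗[k] H)).smulRight (1 : A)) (u ⊗ₜ[k] v) = u * v := by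
  induction u with
  | zero => simp
  | add u₁ u₂ h₁ h₂ => rw [TensorProduct.add_tmul, map_add, h₁, h₂, add_mul]
  | tmul a h =>
    induction v with
    | zero => simp
    | add u₁ u₂ h₁ h₂ => rw [TensorProduct.tmul_add, map_add, h₁, h₂, mul_add]
    | tmul c g =>
      rw [crossedMul_trivialAct, crossedCocycleMul, LinearMap.comp_apply,
        TensorProduct.map_counit_comul]
      simp

/-- The coalgebra map `a ⊗ h ↦ φ(a) ψ(h)`. -/
def tensorLift (φ : A →ₗc[k] E) (ψ : H →ₗc[k] E) : A ⊗[k] H →ₗc[k] E :=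
  (Bialgebra.mulCoalgHom k E).comp (Coalgebra.TensorProduct.map φ ψ)

@[simp]
theorem tensorLift_tmul (φ : A →ₗc[k] E) (ψ : H →ₗc[k] E) (a : A) (h : H) :
    tensorLift φ ψ (a ⊗ₜ[k] h) = φ a * ψ h := by
  simp [tensorLift]

/-- With trivial action the product is ac f(h₁,g₁) # h₂g₂. Centrality of φ(c) moves it past ψ(h), so
only the products ψ(h)ψ(g) have to be matched. -/
theorem tensorLift_crossedMul (φ : A →ₐc[k] E) (ψ : H →ₗc[k] E) (hφ : ∀ a b, φ a * b = b * φ a)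
    (hf : ∀ h g, tensorLift (φ : A →ₗc[k] E) ψ (crossedCocycleMul f (h ⊗ₜ[k] g)) = ψ h * ψ g)
    (u v : A ⊗[k] H) :
    tensorLift (φ : A →ₗc[k] E) ψ (crossedMul (trivialAct k A H) f (u ⊗ₜ[k] v)) =
      tensorLift (φ : A →ₗc[k] E) ψ u * tensorLift (φ : A →ₗc[k] E) ψ v := by
  have key (b : A) (w : A ⊗[k] H) : tensorLift (φ : A →ₗc[k] E) ψ ((b ⊗ₜ[k] 1) * w) =
      φ b * tensorLift (φ : A →ₗc[k] E) ψ w := by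
    induction w with
    | zero => simp
    | add u₁ u₂ h₁ h₂ => rw [mul_add, map_add, h₁, h₂, map_add, mul_add]
    | tmul a h => simp [mul_assoc]
  induction u with
  | zero => simp
  | add u₁ u₂ h₁ h₂ => rw [TensorProduct.add_tmul, map_add, map_add, h₁, h₂, map_add, add_mul]
  | tmul a h =>
    induction v with
    | zero => simp
    | add u₁ u₂ h₁ h₂ => rw [TensorProduct.tmul_add, map_add, map_add, h₁, h₂, map_add, mul_add]
    | tmul c g =>
      rw [crossedMul_trivialAct, key, hf, map_mul, tensorLift_tmul, tensorLift_tmul,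
        BialgHom.coe_toCoalgHom, mul_assoc, mul_assoc, ← mul_assoc (φ c), hφ c, mul_assoc]

end Transport

/-! ### Cohomologous crossed systems -/

section Cohomology

theorem convMul_counit_left {k C A : Type*} [Field k] [AddCommGroup C] [Module k C]
    [Coalgebra k C] [Ring A] [Algebra k A] (φ : C →ₗ[k] A) :
    convMul ((Coalgebra.counit (R := k) (A := C)).smulRight (1 : A)) φ = φ := by
  ext c
  simp [convMul, TensorProduct.map_counit_comul]

theorem convMul_counit_right {k C A : Type*} [Field k] [AddCommGroup C] [Module k C]
    [Coalgebra k C] [Ring A] [Algebra k A] (φ : C →ₗ[k] A) :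
    convMul φ ((Coalgebra.counit (R := k) (A := C)).smulRight (1 : A)) = φ := by
  ext c
  simp [convMul, TensorProduct.map_comul_counit]

variable {k A H : Type*} [Field k] [Ring A] [Ring H] [HopfAlgebra k A] [HopfAlgebra k H]

/-- If every unitary cocentral map is trivial, then cohomologous crossed systems are equal. -/
theorem cohomologous_iff_eq
    (htriv : ∀ r : H →ₗc[k] A, r 1 = 1 → IsCocentral r →
      (r : H →ₗ[k] A) = (Coalgebra.counit (R := k) (A := H)).smulRight (1 : A))
    (X Y : CrossedSystem k A H) : Cohomologous X Y ↔ X = Y := by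
  -- For trivial r, every factor in the definition other than the action and the cocycle becomes a
  -- convolution unit; the factor h ▷ r(g) does so because h ▷ 1 = ε(h)1.
  have key (r : H →ₗc[k] A)
      (hr : (r : H →ₗ[k] A) = (Coalgebra.counit (R := k) (A := H)).smulRight (1 : A)) :
      (∀ (h : H) (a : A), X.act h a = convMul (r : H →ₗ[k] A)
        (convMul (X.act.flip a) (HopfAlgebra.antipode k ∘ₗ (r : H →ₗ[k] A))) h) ∧
      X.coc = convMul ((TensorProduct.rid k A).toLinearMap ∘ₗ
          TensorProduct.map (r : H →ₗ[k] A) (Coalgebra.counit (R := k) (A := H)))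
        (convMul (TensorProduct.lift X.act ∘ₗ (r : H →ₗ[k] A).lTensor H)
          (convMul X.coc (HopfAlgebra.antipode k ∘ₗ (r : H →ₗ[k] A) ∘ₗ LinearMap.mul' k H))) := by
    have e1 : HopfAlgebra.antipode k ∘ₗ (r : H →ₗ[k] A) =
        (Coalgebra.counit (R := k) (A := H)).smulRight (1 : A) := by
      rw [hr]
      ext
      simp
    have e2 : (TensorProduct.rid k A).toLinearMap ∘ₗ
        TensorProduct.map (r : H →ₗ[k] A) (Coalgebra.counit (R := k) (A := H)) =
          (Coalgebra.counit (R := k) (A := H ⊗[k] H)).smulRight (1 : A) := by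
      rw [hr]
      ext
      simp [smul_smul]
    have e3 : TensorProduct.lift X.act ∘ₗ (r : H →ₗ[k] A).lTensor H =
        (Coalgebra.counit (R := k) (A := H ⊗[k] H)).smulRight (1 : A) := by
      rw [hr]
      ext
      simp [X.isCrossedSystem.weakAction.act_one, smul_smul]
    have e4 : HopfAlgebra.antipode k ∘ₗ (r : H →ₗ[k] A) ∘ₗ LinearMap.mul' k H =
        (Coalgebra.counit (R := k) (A := H ⊗[k] H)).smulRight (1 : A) := by
      rw [← LinearMap.comp_assoc, e1]
      ext
      simp [mul_comm]
    refine ⟨fun h a => ?_, ?_⟩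
    · rw [e1, hr, convMul_counit_left, convMul_counit_right, LinearMap.flip_apply]
    · rw [e2, e3, e4, convMul_counit_left, convMul_counit_left, convMul_counit_right]
  constructor
  · rintro ⟨r, h1, hc, hact, hcoc⟩
    obtain ⟨k1, k2⟩ := key r (htriv r h1 hc)
    refine CrossedSystem.ext (LinearMap.ext fun h => LinearMap.ext fun a => ?_) (k2.trans hcoc.symm)
    rw [hact, k1]
  · rintro rfl
    -- Reflexivity is witnessed by the unit of A composed with ε, which is cocentral by the counit
    -- axioms.
    let r : H →ₗc[k] A := ((Bialgebra.unitBialgHom k A).comp (Bialgebra.counitBialgHom k H) :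
      H →ₐc[k] A)
    have hr : (r : H →ₗ[k] A) = (Coalgebra.counit (R := k) (A := H)).smulRight (1 : A) := by
      ext h
      exact Algebra.algebraMap_eq_smul_one _
    refine ⟨r, map_one ((Bialgebra.unitBialgHom k A).comp (Bialgebra.counitBialgHom k H)), ?_,
      (key r hr).1, (key r hr).2⟩
    intro h
    rw [hr, LinearMap.rTensor, TensorProduct.map_counit_comul, ← TensorProduct.comm_tmul,
      ← TensorProduct.map_comul_counit, TensorProduct.map_comm]

namespace Sweedler

variable (k) {p : ℕ} [Fact p.Prime] [CharP k p]

/-- Cocentrality compares r(x) ⊗ 1 + r(g) ⊗ x with 1 ⊗ x + r(x) ⊗ g at x, and r(gx) ⊗ g + 1 ⊗ gx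
with r(g) ⊗ gx + r(gx) ⊗ 1 at gx. -/
theorem cocentral_eq (r : Sweedler k →ₗc[k] A) (h1 : r 1 = 1) (hr : IsCocentral r) :
    (r : Sweedler k →ₗ[k] A) =
      (Coalgebra.counit (R := k) (A := Sweedler k)).smulRight (1 : A) := by
  have h2 := hr (x k)
  have h3 := hr (g k * x k)
  simp only [comul_x, comul_gx, map_add, TensorProduct.comm_tmul, LinearMap.rTensor_tmul,
    CoalgHom.coe_toLinearMap, h1] at h2 h3
  have e2 := tmul_inj (v₀ := r (x k)) (v₁ := 0) (v₂ := r (g k)) (v₃ := 0) (w₀ := 0)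
    (w₁ := r (x k)) (w₂ := 1) (w₃ := 0) (by simpa [add_comm] using h2)
  have e3 := tmul_inj (v₀ := 0) (v₁ := r (g k * x k)) (v₂ := 0) (v₃ := 1) (w₀ := r (g k * x k))
    (w₁ := 0) (w₂ := 0) (w₃ := r (g k)) (by simpa [add_comm] using h3)
  refine linearMap_ext ?_ ?_ ?_ ?_
  · simp [h1]
  · simp [e2.2.2.1]
  · simp [e2.1]
  · simp [e3.2.1]

end Sweedler

end Cohomology


/-! ### Realising the nonzero cocycles in A_{4p} -/

namespace TruncPoly

variable {k : Type*} [Field k] {p : ℕ}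

/-- `TruncPoly.algHom_ext` asks for a commutative target, whereas the targets below include A_{4p}
and quaternion algebras. -/
theorem algHom_ext_ring {B : Type*} [Ring B] [Algebra k B] {φ ψ : TruncPoly k p →ₐ[k] B}
    (h : φ (y k p) = ψ (y k p)) : φ = ψ :=
  AlgHom.ext_of_adjoin_eq_top (adjoin_eq_top k p) (by rintro _ rfl; exact h)

end TruncPoly

namespace Sweedler

variable {k E : Type*} [Field k] [Ring E] [Bialgebra k E]

/-- The linear map `1 ↦ 1`, `g ↦ G`, `x ↦ X`, `g x ↦ G X`, for `G` group-like and `X` skew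
primitive, as a map of coalgebras. -/
def coalgLift (G X : E) (hG : IsGroupLikeElem k G)
    (hX : Coalgebra.comul (R := k) X = X ⊗ₜ[k] 1 + G ⊗ₜ[k] X)
    (hX0 : Coalgebra.counit (R := k) X = 0) (hGG : G * G = 1) : Sweedler k →ₗc[k] E where
  -- Defined only linearly on the basis: X² need not vanish, so this is in general not an algebra
  -- map.
  __ := (basis k).constr k ![1, G, X, G * X]
  counit_comp := by
    refine (basis k).ext fun i => ?_
    rw [LinearMap.comp_apply, Module.Basis.constr_basis, basis_eq]
    fin_cases i <;> simp [hG.counit_eq_one, hX0]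
  map_comp_comul := by
    have hc (i : Fin 4) : (basis k).constr k ![1, G, X, G * X] (![1, g k, x k, g k * x k] i) =
        ![1, G, X, G * X] i := by
      rw [← basis_eq, Module.Basis.constr_basis]
    have hGX : Coalgebra.comul (R := k) (G * X) = (G * X) ⊗ₜ[k] G + 1 ⊗ₜ[k] (G * X) := by
      rw [Bialgebra.comul_mul, hG.comul_eq_tmul_self, hX, mul_add,
        Algebra.TensorProduct.tmul_mul_tmul, Algebra.TensorProduct.tmul_mul_tmul, mul_one, hGG]
    have h0 := hc 0
    have h1 := hc 1
    have h2 := hc 2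
    have h3 := hc 3
    simp only [Matrix.cons_val] at h0 h1 h2 h3
    refine linearMap_ext ?_ ?_ ?_ ?_ <;>
    simp only [LinearMap.comp_apply, Bialgebra.comul_one, comul_g, comul_x, comul_gx, map_add,
      Algebra.TensorProduct.one_def, TensorProduct.map_tmul, h0, h1, h2, h3, hX,
      hG.comul_eq_tmul_self, hGX]

variable (G X : E) (hG : IsGroupLikeElem k G)
    (hX : Coalgebra.comul (R := k) X = X ⊗ₜ[k] 1 + G ⊗ₜ[k] X)
    (hX0 : Coalgebra.counit (R := k) X = 0) (hGG : G * G = 1)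

theorem coalgLift_apply (i : Fin 4) :
    coalgLift G X hG hX hX0 hGG (![1, g k, x k, g k * x k] i) = ![1, G, X, G * X] i := by
  rw [← basis_eq]
  exact (basis k).constr_basis k _ i

theorem coalgLift_one : coalgLift G X hG hX hX0 hGG 1 = 1 := coalgLift_apply G X hG hX hX0 hGG 0

theorem coalgLift_g : coalgLift G X hG hX hX0 hGG (g k) = G := coalgLift_apply G X hG hX hX0 hGG 1

theorem coalgLift_x : coalgLift G X hG hX hX0 hGG (x k) = X := coalgLift_apply G X hG hX hX0 hGG 2

theorem coalgLift_gx : coalgLift G X hG hX hX0 hGG (g k * x k) = G * X :=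
  coalgLift_apply G X hG hX hX0 hGG 3

/-- A check on the sixteen pairs of basis vectors: G² = 1, XG = -GX and X² = φ(l y) reproduce the
signs of `skewForm`. -/
theorem tensorLift_cocycleMul {E : Type*} [Ring E] [HopfAlgebra k E] (G X : E)
    (hG : IsGroupLikeElem k G)
    (hX : Coalgebra.comul (R := k) X = X ⊗ₜ[k] 1 + G ⊗ₜ[k] X)
    (hX0 : Coalgebra.counit (R := k) X = 0) (hGG : G * G = 1)
    {p : ℕ} [Fact p.Prime] [CharP k p] (φ : TruncPoly k p →ₐc[k] E)
    (l : k) (hXG : X * G = -(G * X)) (hXX : X * X = φ (l • TruncPoly.y k p)) (h h' : Sweedler k) :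
    tensorLift (φ : TruncPoly k p →ₗc[k] E) (coalgLift G X hG hX hX0 hGG)
      (crossedCocycleMul (cocycle k p l) (h ⊗ₜ[k] h')) =
        coalgLift G X hG hX hX0 hGG h * coalgLift G X hG hX hX0 hGG h' := by
  set ψ := coalgLift G X hG hX hX0 hGG with hψ
  have h0 := coalgLift_one G X hG hX hX0 hGG
  have h1 := coalgLift_g G X hG hX hX0 hGG
  have h2 := coalgLift_x G X hG hX hX0 hGG
  have h3 := coalgLift_gx G X hG hX hX0 hGG
  rw [← hψ] at h0 h1 h2 h3
  have hGGX : G * (G * X) = X := by rw [← mul_assoc, hGG, one_mul]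
  have hGXG : G * X * G = -X := by rw [mul_assoc, hXG, mul_neg, hGGX]
  have hXGX : X * (G * X) = -(φ (l • TruncPoly.y k p) * G) := by
    rw [← hXX, mul_assoc, hXG, mul_neg, neg_neg]
  have hGXX : G * X * X = φ (l • TruncPoly.y k p) * G := by
    rw [← neg_inj, ← hXGX, ← mul_assoc, hXG, neg_mul]
  have hGXGX : G * X * (G * X) = -φ (l • TruncPoly.y k p) := by
    rw [← mul_assoc, hGXG, neg_mul, hXX]
  have key : ((tensorLift (φ : TruncPoly k p →ₗc[k] E) ψ :
      TruncPoly k p ⊗[k] Sweedler k →ₗ[k] E) ∘ₗ crossedCocycleMul (cocycle k p l)) =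
      LinearMap.mul' k E ∘ₗ TensorProduct.map (ψ : Sweedler k →ₗ[k] E)
        (ψ : Sweedler k →ₗ[k] E) := by
    refine TensorProduct.ext (linearMap_ext ?_ ?_ ?_ ?_) <;>
    refine linearMap_ext ?_ ?_ ?_ ?_ <;>
    simp [-Module.Basis.coord_apply, -Bialgebra.comul_mul, -Bialgebra.counit_mul, crossedCocycleMul,
      Algebra.TensorProduct.one_def, TensorProduct.tmul_neg, TensorProduct.neg_tmul,
      cocycle_tmul, coord_one, coord_g, coord_x, coord_gx, comul_gx, counit_gx, h0, h1, h2, h3,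
      TensorProduct.add_tmul, TensorProduct.tmul_add, hGG, hXG, hXX, hGGX, hGXG, hXGX, hGXX, hGXGX,
      g_mul_g, x_mul_x, x_mul_g, g_mul_gx, x_mul_gx, gx_mul_g, gx_mul_x, gx_mul_gx]
  exact DFunLike.congr_fun key (h ⊗ₜ[k] h')

end Sweedler

namespace FourP

variable (k : Type*) [Field k] (p : ℕ)

theorem x_sq_mul_comm (b : FourP k p) : b * x k p ^ 2 = x k p ^ 2 * b := by
  have h : Algebra.adjoin k {g k p, x k p} ≤ Subalgebra.centralizer k {x k p ^ 2} := by
    refine Algebra.adjoin_le ?_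
    rintro b (rfl | rfl) _ rfl
    · rw [pow_two, mul_assoc, x_mul_g, mul_neg, ← mul_assoc, x_mul_g, neg_mul, neg_neg, mul_assoc]
    · rw [← pow_succ, ← pow_succ']
  rw [adjoin_eq_top] at h
  exact (Subalgebra.mem_centralizer_iff k).1 (h (Algebra.mem_top (x := b))) _ rfl |>.symm

theorem x_sq_mem_center : x k p ^ 2 ∈ Subalgebra.center k (FourP k p) :=
  Subalgebra.mem_center_iff.2 (x_sq_mul_comm k p)

/-- The map `y ↦ c x²` into the center. -/
def centerHom (c : k) : TruncPoly k p →ₐ[k] Subalgebra.center k (FourP k p) :=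
  -- `TruncPoly.lift` needs a commutative target. Passing through the center provides one and makes
  -- `polyHom_comm` immediate.
  TruncPoly.lift (c • ⟨x k p ^ 2, x_sq_mem_center k p⟩) (Subtype.ext (by
    simp [smul_pow, ← pow_mul, x_pow]))

theorem centerHom_y (c : k) : (centerHom k p c (TruncPoly.y k p) : FourP k p) = c • x k p ^ 2 := by
  simp [centerHom]

variable [Fact p.Prime] [CharP k p]

/-- The cross terms xg ⊗ x and gx ⊗ x cancel, which is why multiples of x² can serve as images of y.
-/
theorem comul_x_sq : Coalgebra.comul (R := k) (x k p ^ 2) =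
    (x k p ^ 2) ⊗ₜ[k] 1 + 1 ⊗ₜ[k] (x k p ^ 2) := by
  rw [pow_two, Bialgebra.comul_mul, comul_x]
  simp only [mul_add, add_mul, Algebra.TensorProduct.tmul_mul_tmul, g_mul_g, x_mul_g,
      mul_one, one_mul, TensorProduct.neg_tmul]
  abel

/-- The map `k⟨y | y ^ p = 0⟩ → A_{4p}`, `y ↦ c x²`. -/
def polyHom (c : k) : TruncPoly k p →ₐc[k] FourP k p :=
  BialgHom.ofAlgHom ((Subalgebra.center k (FourP k p)).val.comp (centerHom k p c))
    (TruncPoly.algHom_ext (by simp [centerHom_y]))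
    (TruncPoly.algHom_ext_ring (by
      simp [-Bialgebra.comul_pow, centerHom_y, comul_x_sq, TensorProduct.smul_tmul', TensorProduct.tmul_smul]))

theorem polyHom_y (c : k) : polyHom k p c (TruncPoly.y k p) = c • x k p ^ 2 :=
  centerHom_y k p c

theorem polyHom_comm (c : k) (a : TruncPoly k p) (b : FourP k p) :
    polyHom k p c a * b = b * polyHom k p c a :=
  (Subalgebra.mem_center_iff.1 (centerHom k p c a).2 b).symm

theorem isGroupLikeElem_g : IsGroupLikeElem k (g k p) := ⟨counit_g k p, comul_g k p⟩

/-- The coalgebra map `A ⊗ H₄ → A_{4p}`, `y ↦ c x²`, `g ↦ g`, `x ↦ x`. -/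
def tensorHom (c : k) : TruncPoly k p ⊗[k] Sweedler k →ₗc[k] FourP k p :=
  tensorLift (polyHom k p c : TruncPoly k p →ₗc[k] FourP k p)
    (Sweedler.coalgLift (g k p) (x k p) (isGroupLikeElem_g k p) (comul_x k p) (counit_x k p)
      (g_mul_g k p))

theorem tensorHom_tmul_one (c : k) (a : TruncPoly k p) :
    tensorHom k p c (a ⊗ₜ[k] 1) = polyHom k p c a := by
  simp [tensorHom, Sweedler.coalgLift_one]

theorem tensorHom_tmul_g (c : k) (a : TruncPoly k p) :
    tensorHom k p c (a ⊗ₜ[k] Sweedler.g k) = polyHom k p c a * g k p := by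
  simp [tensorHom, Sweedler.coalgLift_g]

theorem tensorHom_tmul_x (c : k) (a : TruncPoly k p) :
    tensorHom k p c (a ⊗ₜ[k] Sweedler.x k) = polyHom k p c a * x k p := by
  simp [tensorHom, Sweedler.coalgLift_x]

theorem tensorHom_tmul_gx (c : k) (a : TruncPoly k p) :
    tensorHom k p c (a ⊗ₜ[k] (Sweedler.g k * Sweedler.x k)) =
      polyHom k p c a * (g k p * x k p) := by
  simp [tensorHom, Sweedler.coalgLift_gx]

/-- The scalar l⁻¹ is the one that sends f(x,x) = l y to x · x. -/
theorem tensorHom_crossedMul {l : k} (hl : l ≠ 0) (u v : TruncPoly k p ⊗[k] Sweedler k) :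
    tensorHom k p l⁻¹ (crossedMul (trivialAct k _ _) (Sweedler.cocycle k p l) (u ⊗ₜ[k] v)) =
      tensorHom k p l⁻¹ u * tensorHom k p l⁻¹ v := by
  refine tensorLift_crossedMul (polyHom k p l⁻¹) _ (polyHom_comm k p l⁻¹) (fun h h' => ?_) u v
  refine Sweedler.tensorLift_cocycleMul _ _ _ _ _ _ _ l (x_mul_g k p) ?_ h h'
  rw [map_smul, polyHom_y, smul_smul, mul_inv_cancel₀ hl, one_smul, pow_two]

/-- The representation of `A_{4p}` on the quaternion algebra over `k⟨y | y ^ p = 0⟩` with `i² = 1`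
and `j² = l y`. -/
def toQuaternion (l : k) :
    FourP k p →ₐ[k] QuaternionAlgebra (TruncPoly k p) 1 0 (l • TruncPoly.y k p) :=
  lift ⟨0, 1, 0, 0⟩ ⟨0, 0, 1, 0⟩
    (by
      have h : (⟨0, 0, 1, 0⟩ : QuaternionAlgebra (TruncPoly k p) 1 0 (l • TruncPoly.y k p)) ^ 2 =
          algebraMap (TruncPoly k p) _ (l • TruncPoly.y k p) := by
        rw [pow_two]
        ext <;> simp
      rw [pow_mul, h, ← map_pow, smul_pow, TruncPoly.y_pow, smul_zero, map_zero])
    (by ext <;> simp) (by ext <;> simp)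

theorem toQuaternion_polyHom {l : k} (hl : l ≠ 0) (a : TruncPoly k p) :
    toQuaternion k p l (polyHom k p l⁻¹ a) = algebraMap (TruncPoly k p) _ a := by
  have h : (toQuaternion k p l).comp (polyHom k p l⁻¹ : TruncPoly k p →ₐ[k] FourP k p) =
      IsScalarTower.toAlgHom k (TruncPoly k p)
        (QuaternionAlgebra (TruncPoly k p) 1 0 (l • TruncPoly.y k p)) := by
    refine TruncPoly.algHom_ext_ring ?_
    simp only [AlgHom.comp_apply, BialgHom.coe_toAlgHom, polyHom_y, map_smul, map_pow,
      IsScalarTower.coe_toAlgHom']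
    rw [toQuaternion, lift_x, pow_two]
    ext <;> simp [hl]
  exact DFunLike.congr_fun h a

/-- Followed by `toQuaternion`, the map sends v₀ ⊗ 1 + v₁ ⊗ g + v₂ ⊗ x + v₃ ⊗ gx to the quaternion
v₀ + v₁i + v₂j + v₃ij. This bounds the dimension of A_{4p} from below. -/
theorem tensorHom_injective {l : k} (hl : l ≠ 0) : Function.Injective (tensorHom k p l⁻¹) := by
  refine (injective_iff_map_eq_zero _).2 fun u hu => ?_
  obtain ⟨v₀, v₁, v₂, v₃, rfl⟩ := Sweedler.exists_tmul_eq u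
  have h := congrArg (toQuaternion k p l) hu
  simp only [map_add, tensorHom_tmul_one, tensorHom_tmul_g, tensorHom_tmul_x, tensorHom_tmul_gx,
    map_mul, toQuaternion_polyHom k p hl, map_zero] at h
  rw [toQuaternion, lift_g, lift_x] at h
  simp [QuaternionAlgebra.ext_iff] at h
  simp [h]

theorem tensorHom_one (c : k) : tensorHom k p c (1 ⊗ₜ[k] 1) = 1 := by
  rw [tensorHom_tmul_one, map_one]

/-- The range contains g and x, and `tensorHom_crossedMul` makes it closed under multiplication. -/
theorem tensorHom_surjective {l : k} (hl : l ≠ 0) : Function.Surjective (tensorHom k p l⁻¹) := by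
  intro b
  have hb : b ∈ Algebra.adjoin k {g k p, x k p} := adjoin_eq_top k p ▸ Algebra.mem_top
  induction hb using Algebra.adjoin_induction with
  | mem b hb =>
    rcases hb with rfl | rfl
    · exact ⟨1 ⊗ₜ[k] Sweedler.g k, by rw [tensorHom_tmul_g, map_one, one_mul]⟩
    · exact ⟨1 ⊗ₜ[k] Sweedler.x k, by rw [tensorHom_tmul_x, map_one, one_mul]⟩
  | algebraMap r =>
    exact ⟨r • (1 ⊗ₜ[k] 1), by rw [map_smul, tensorHom_one, Algebra.algebraMap_eq_smul_one]⟩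
  | add a b _ _ ha hb =>
    obtain ⟨u, rfl⟩ := ha
    obtain ⟨v, rfl⟩ := hb
    exact ⟨u + v, map_add _ _ _⟩
  | mul a b _ _ ha hb =>
    obtain ⟨u, rfl⟩ := ha
    obtain ⟨v, rfl⟩ := hb
    exact ⟨_, tensorHom_crossedMul k p hl u v⟩

/-- The coalgebra `A_{4p}` is isomorphic to `A ⊗ H₄`. -/
def tensorEquiv {l : k} (hl : l ≠ 0) : (TruncPoly k p ⊗[k] Sweedler k) ≃ₗc[k] FourP k p :=
  { tensorHom k p l⁻¹, Equiv.ofBijective (tensorHom k p l⁻¹)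
    ⟨tensorHom_injective k p hl, tensorHom_surjective k p hl⟩ with }

theorem finrank_eq : Module.finrank k (FourP k p) = 4 * p := by
  rw [← (tensorEquiv k p (one_ne_zero (α := k))).toLinearEquiv.finrank_eq,
    Module.finrank_tensorProduct, TruncPoly.finrank_eq,
    Module.finrank_eq_card_basis (Sweedler.basis k), Fintype.card_fin, mul_comm]

theorem x_sq_ne_zero : x k p ^ 2 ≠ 0 := by
  intro h
  have h1 : tensorHom k p 1⁻¹ (TruncPoly.y k p ⊗ₜ[k] 1) = 0 := by
    rw [tensorHom_tmul_one, polyHom_y, h, smul_zero]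
  have h2 := tensorHom_injective k p one_ne_zero (h1.trans (map_zero _).symm)
  refine TruncPoly.y_ne_zero k p (Fact.out : p.Prime).one_lt
    (Sweedler.tmul_inj (k := k) (v₁ := 0) (v₂ := 0) (v₃ := 0) (w₀ := 0) (w₁ := 0) (w₂ := 0)
      (w₃ := 0) ?_).1
  simpa using h2

/-- Group-like and skew-primitive elements depend only on the coalgebra and the elements 1 and g.
The results for A ⊗ H₄ thus carry over along `tensorEquiv` with l = 1, although it does not respect
the tensor product multiplication. -/
theorem eq_g_of_isGroupLikeElem {u : FourP k p} (hu : IsGroupLikeElem k u) (h1 : u ≠ 1) :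
    u = g k p := by
  let e := tensorEquiv k p (one_ne_zero (α := k))
  have h := eq_one_tmul_g (hu.map e.symm) (fun h => h1 (by
    have h' := congrArg e h
    rw [e.apply_symm_apply] at h'
    exact h'.trans (tensorHom_one k p _)))
  have h' := congrArg e h
  rw [e.apply_symm_apply] at h'
  rw [h']
  exact (tensorHom_tmul_g k p _ _).trans (by rw [map_one, one_mul])

theorem exists_eq_of_skewPrimitive {u : FourP k p}
    (hu : Coalgebra.comul (R := k) u = u ⊗ₜ[k] 1 + g k p ⊗ₜ[k] u) :
    ∃ a c : k, u = a • (1 - g k p) + c • x k p := by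
  let e := tensorEquiv k p (one_ne_zero (α := k))
  have he1 : e 1 = 1 := tensorHom_one k p _
  have heg : e (1 ⊗ₜ[k] Sweedler.g k) = g k p :=
    (tensorHom_tmul_g k p _ _).trans (by rw [map_one, one_mul])
  have hex : e (1 ⊗ₜ[k] Sweedler.x k) = x k p :=
    (tensorHom_tmul_x k p _ _).trans (by rw [map_one, one_mul])
  obtain ⟨a, c, h⟩ := exists_eq_one_tmul (u := e.symm u) (by
    rw [← CoalgHomClass.map_comp_comul_apply e.symm, hu, map_add, TensorProduct.map_tmul,
      TensorProduct.map_tmul]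
    have e1 : e.symm 1 = 1 := by rw [← he1, e.symm_apply_apply]
    have e2 : e.symm (g k p) = 1 ⊗ₜ[k] Sweedler.g k := by rw [← heg, e.symm_apply_apply]
    simp [e1, e2])
  refine ⟨a, c, ?_⟩
  have h' := congrArg e h
  rw [e.apply_symm_apply, TensorProduct.tmul_add, TensorProduct.tmul_smul, TensorProduct.tmul_smul,
    TensorProduct.tmul_sub, ← Algebra.TensorProduct.one_def, map_add, map_smul, map_smul, map_sub,
    he1, heg, hex] at h'
  exact h'

end FourP


/-! ### Automorphisms of A_{4p} -/

theorem two_ne_zero_of_three_le (k : Type*) [Field k] {p : ℕ} [CharP k p] (hp : 3 ≤ p) :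
    (2 : k) ≠ 0 := by
  have h : ((2 : ℕ) : k) ≠ 0 := by
    rw [Ne, CharP.cast_eq_zero_iff k p]
    exact fun h => absurd (Nat.le_of_dvd two_pos h) (by omega)
  exact_mod_cast h

/-- As 1 - G commutes with G and X anticommutes with it, the condition reduces to 2a(G - 1) = 0.
This removes the term a(1 - g) from skew-primitive images of x. -/
theorem eq_zero_of_anticommute {k E : Type*} [Field k] [Ring E] [Algebra k E] (h2 : (2 : k) ≠ 0)
    {G X : E} (hG : G * G = 1) (hXG : X * G = -(G * X)) (hG1 : G ≠ 1) {a c : k}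
    (h : (a • (1 - G) + c • X) * G = -(G * (a • (1 - G) + c • X))) : a = 0 := by
  have h' : (2 * a) • (G - 1) = 0 := by
    simp only [add_mul, mul_add, smul_mul_assoc, mul_smul_comm, sub_mul, mul_sub, hG, hXG, one_mul,
      mul_one, smul_neg, neg_add, add_left_inj] at h
    rw [mul_smul, two_smul]
    nth_rewrite 1 [h]
    exact neg_add_cancel _
  simpa [h2, sub_eq_zero, hG1] using h'

namespace FourP

variable (k : Type*) [Field k] (p : ℕ)

/-- The character g ↦ -1, x ↦ 0 separates g from 1. -/
theorem g_ne_one (h2 : (2 : k) ≠ 0) (hp : p ≠ 0) : g k p ≠ 1 := by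
  intro h
  have h' := congrArg (lift (k := k) (p := p) (-1 : k) 0 (zero_pow (by omega)) (by simp) (by simp)) h
  rw [lift_g, map_one, neg_eq_iff_add_eq_zero, one_add_one_eq_two] at h'
  exact h2 h'

variable [Fact p.Prime] [CharP k p]

variable {k p} in
/-- An injective map of bialgebras to `A_{4p}` sends an anticommuting pair of a group-like
involution `G` and a `(G, 1)`-primitive element to `g` and a multiple of `x`. -/
theorem map_generators (h2 : (2 : k) ≠ 0) {E : Type*} [Ring E] [Bialgebra k E]
    (e : E ≃ₐc[k] FourP k p) {G X : E} (hG : IsGroupLikeElem k G) (hG1 : G ≠ 1)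
    (hX : Coalgebra.comul (R := k) X = X ⊗ₜ[k] 1 + G ⊗ₜ[k] X) (hXG : X * G = -(G * X)) :
    e G = g k p ∧ ∃ c : k, e X = c • x k p := by
  have hg : e G = g k p := eq_g_of_isGroupLikeElem k p (hG.map e)
    fun h => hG1 (EquivLike.injective e (h.trans (map_one e).symm))
  refine ⟨hg, ?_⟩
  obtain ⟨a, c, h⟩ := exists_eq_of_skewPrimitive k p (u := e X) (by
    rw [← CoalgHomClass.map_comp_comul_apply e, hX, map_add, TensorProduct.map_tmul,
      TensorProduct.map_tmul, ← hg]
    simp)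
  have ha : a = 0 := by
    refine eq_zero_of_anticommute (c := c) h2 (g_mul_g k p) (x_mul_g k p)
      (g_ne_one k p h2 (Fact.out : p.Prime).ne_zero) ?_
    rw [← h, ← hg, ← map_mul, hXG, map_neg, map_mul]
  exact ⟨c, by rw [h, ha, zero_smul, zero_add]⟩

/-- The endomorphism `g ↦ g`, `x ↦ c x` of `A_{4p}`. -/
def scale (c : k) : FourP k p →ₐc[k] FourP k p :=
  BialgHom.ofAlgHom
    (lift (g k p) (c • x k p) (by rw [smul_pow, x_pow, smul_zero]) (g_mul_g k p)
      (by rw [smul_mul_assoc, x_mul_g, mul_smul_comm, smul_neg]))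
    (algHom_ext (by simp) (by simp))
    (algHom_ext (by simp) (by simp [TensorProduct.smul_tmul', TensorProduct.tmul_smul]))

@[simp]
theorem scale_g (c : k) : scale k p c (g k p) = g k p := lift_g ..

@[simp]
theorem scale_x (c : k) : scale k p c (x k p) = c • x k p := lift_x ..

variable {k p} in
theorem bialgHom_ext {B : Type*} [Ring B] [Bialgebra k B] {φ ψ : FourP k p →ₐc[k] B}
    (hg : φ (g k p) = ψ (g k p)) (hx : φ (x k p) = ψ (x k p)) : φ = ψ :=
  BialgHom.coe_toAlgHom_injective (algHom_ext hg hx)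

/-- The automorphism `g ↦ g`, `x ↦ c x` of `A_{4p}`. -/
def scaleEquiv (c : kˣ) : FourP k p ≃ₐc[k] FourP k p :=
  BialgEquiv.ofBialgHom (scale k p c) (scale k p (c⁻¹ : kˣ))
    (bialgHom_ext (by simp) (by simp [smul_smul]))
    (bialgHom_ext (by simp) (by simp [smul_smul]))

theorem x_ne_zero : x k p ≠ 0 := fun h => x_sq_ne_zero k p (by rw [h, zero_pow two_ne_zero])

/-- The automorphisms of `A_{4p}` are the scalings of `x`. -/
def unitsEquivAut (h2 : (2 : k) ≠ 0) : kˣ ≃* (FourP k p ≃ₐc[k] FourP k p) :=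
  MulEquiv.ofBijective
    (MonoidHom.mk' (scaleEquiv k p) (fun c d => BialgEquiv.ext fun b => by
      change scale k p _ b = ((scale k p c).comp (scale k p d)) b
      exact BialgHom.congr_fun (bialgHom_ext (by simp) (by simp [smul_smul, mul_comm])) b))
    ⟨fun c d h => by
      have h' : scale k p c (x k p) = scale k p d (x k p) := DFunLike.congr_fun h (x k p)
      rw [scale_x, scale_x] at h'
      exact Units.ext (smul_left_injective k (x_ne_zero k p) h'),
    fun e => by
      obtain ⟨hg, c, hc⟩ := map_generators h2 e (isGroupLikeElem_g k p)
        (g_ne_one k p h2 (Fact.out : p.Prime).ne_zero) (comul_x k p) (x_mul_g k p)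
      have hc0 : c ≠ 0 := by
        rintro rfl
        rw [zero_smul] at hc
        exact x_ne_zero k p (EquivLike.injective e (hc.trans (map_zero e).symm))
      refine ⟨Units.mk0 c hc0, BialgEquiv.ext fun b => ?_⟩
      change scale k p c b = (e : FourP k p →ₐc[k] FourP k p) b
      exact BialgHom.congr_fun (bialgHom_ext (by simp [hg]) (by simp [hc])) b⟩

end FourP

/-! ### Scalings of the two tensor factors -/

namespace TruncPoly

variable (k : Type*) [Field k] (p : ℕ) [Fact p.Prime] [CharP k p]

/-- The endomorphism `y ↦ c y` of `k⟨y | y ^ p = 0⟩`. -/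
def scale (c : k) : TruncPoly k p →ₐc[k] TruncPoly k p :=
  BialgHom.ofAlgHom (lift (c • y k p) (by rw [smul_pow, y_pow, smul_zero]))
    (algHom_ext (by simp))
    (algHom_ext (by simp [TensorProduct.smul_tmul', TensorProduct.tmul_smul]))

@[simp]
theorem scale_y (c : k) : scale k p c (y k p) = c • y k p :=
  lift_y (c • y k p) (by rw [smul_pow, y_pow, smul_zero])

end TruncPoly

namespace Sweedler

variable (k : Type*) [Field k]

theorem smul_x_mul_smul_x (c : k) : c • x k * c • x k = 0 := by simp [x_mul_x]

theorem smul_x_mul_g (c : k) : c • x k * g k = -(g k * c • x k) := by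
  rw [smul_mul_assoc, x_mul_g, mul_smul_comm, smul_neg]

/-- The endomorphism `g ↦ g`, `x ↦ c x` of `H₄`. -/
def scale (c : k) : Sweedler k →ₐc[k] Sweedler k :=
  BialgHom.ofAlgHom
    (lift (g k) (c • x k) (g_mul_g k) (smul_x_mul_smul_x k c) (smul_x_mul_g k c))
    (algHom_ext (by simp) (by simp))
    (algHom_ext (by simp) (by simp [TensorProduct.smul_tmul', TensorProduct.tmul_smul]))

@[simp]
theorem scale_g (c : k) : scale k c (g k) = g k :=
  lift_g _ _ (g_mul_g k) (smul_x_mul_smul_x k c) (smul_x_mul_g k c)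

@[simp]
theorem scale_x (c : k) : scale k c (x k) = c • x k :=
  lift_x _ _ (g_mul_g k) (smul_x_mul_smul_x k c) (smul_x_mul_g k c)

end Sweedler

/-! ### Automorphisms of `k⟨y | y ^ p = 0⟩ ⊗ H₄` -/

section TensorAut

variable (k : Type*) [Field k] (p : ℕ)

theorem one_tmul_x_mul_g : ((1 : TruncPoly k p) ⊗ₜ[k] Sweedler.x k) * (1 ⊗ₜ[k] Sweedler.g k) =
    -((1 ⊗ₜ[k] Sweedler.g k) * (1 ⊗ₜ[k] Sweedler.x k)) := by
  simp [Sweedler.x_mul_g, TensorProduct.tmul_neg]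

theorem one_tmul_g_ne_one [Fact p.Prime] : (1 : TruncPoly k p) ⊗ₜ[k] Sweedler.g k ≠ 1 := by
  intro h
  exact one_ne_zero (Sweedler.tmul_inj (k := k) (v₀ := (0 : TruncPoly k p)) (v₁ := 1) (v₂ := 0)
    (v₃ := 0) (w₀ := 1) (w₁ := 0) (w₂ := 0) (w₃ := 0)
    (by simpa [Algebra.TensorProduct.one_def] using h)).2.1

theorem one_tmul_x_ne_zero [Fact p.Prime] : (1 : TruncPoly k p) ⊗ₜ[k] Sweedler.x k ≠ 0 := by
  intro h
  exact one_ne_zero (Sweedler.tmul_inj (k := k) (v₀ := (0 : TruncPoly k p)) (v₁ := 0) (v₂ := 1)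
    (v₃ := 0) (w₀ := 0) (w₁ := 0) (w₂ := 0) (w₃ := 0) (by simpa using h)).2.2.1

theorem y_tmul_one_ne_zero [Fact p.Prime] : TruncPoly.y k p ⊗ₜ[k] (1 : Sweedler k) ≠ 0 := by
  intro h
  exact TruncPoly.y_ne_zero k p (Fact.out : p.Prime).one_lt (Sweedler.tmul_inj (k := k) (v₁ := 0)
    (v₂ := 0) (v₃ := 0) (w₀ := 0) (w₁ := 0) (w₂ := 0) (w₃ := 0) (by simpa using h)).1

variable [Fact p.Prime] [CharP k p]

theorem isGroupLikeElem_one_tmul_g :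
    IsGroupLikeElem k ((1 : TruncPoly k p) ⊗ₜ[k] Sweedler.g k) :=
  ⟨by simp, by simp [Algebra.TensorProduct.one_def]⟩

theorem comul_one_tmul_x :
    Coalgebra.comul (R := k) ((1 : TruncPoly k p) ⊗ₜ[k] Sweedler.x k) =
      (1 ⊗ₜ[k] Sweedler.x k) ⊗ₜ[k] 1 + (1 ⊗ₜ[k] Sweedler.g k) ⊗ₜ[k] (1 ⊗ₜ[k] Sweedler.x k) := by
  simp [Algebra.TensorProduct.one_def, TensorProduct.tmul_add]

theorem comul_y_tmul_one :
    Coalgebra.comul (R := k) (TruncPoly.y k p ⊗ₜ[k] (1 : Sweedler k)) =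
      (TruncPoly.y k p ⊗ₜ[k] 1) ⊗ₜ[k] 1 + 1 ⊗ₜ[k] (TruncPoly.y k p ⊗ₜ[k] 1) := by
  simp [Algebra.TensorProduct.one_def, TensorProduct.add_tmul]

/-- An isomorphism would send 1 ⊗ x, of square zero, to some cx with c²x² = 0. As x² ≠ 0 in A_{4p},
this gives c = 0, against injectivity. -/
theorem isEmpty_bialgEquiv_fourP (h2 : (2 : k) ≠ 0) :
    IsEmpty (TruncPoly k p ⊗[k] Sweedler k ≃ₐc[k] FourP k p) := by
  refine ⟨fun e => ?_⟩
  obtain ⟨-, c, hc⟩ := FourP.map_generators h2 e (isGroupLikeElem_one_tmul_g k p)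
    (one_tmul_g_ne_one k p) (comul_one_tmul_x k p) (one_tmul_x_mul_g k p)
  have h := congrArg (· ^ 2) hc
  simp only [← map_pow, smul_pow] at h
  rw [pow_two (1 ⊗ₜ[k] Sweedler.x k), Algebra.TensorProduct.tmul_mul_tmul, Sweedler.x_mul_x,
    TensorProduct.tmul_zero, map_zero] at h
  have hc0 : c = 0 := by simpa [FourP.x_sq_ne_zero] using h.symm
  rw [hc0, zero_smul] at hc
  exact one_tmul_x_ne_zero k p (EquivLike.injective e (hc.trans (map_zero e).symm))

variable {k p} in
theorem tensorBialgHom_ext {B : Type*} [Ring B] [Bialgebra k B]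
    {φ ψ : TruncPoly k p ⊗[k] Sweedler k →ₐc[k] B}
    (hy : φ (TruncPoly.y k p ⊗ₜ[k] 1) = ψ (TruncPoly.y k p ⊗ₜ[k] 1))
    (hg : φ (1 ⊗ₜ[k] Sweedler.g k) = ψ (1 ⊗ₜ[k] Sweedler.g k))
    (hx : φ (1 ⊗ₜ[k] Sweedler.x k) = ψ (1 ⊗ₜ[k] Sweedler.x k)) : φ = ψ :=
  BialgHom.coe_toAlgHom_injective
    (Algebra.TensorProduct.ext (TruncPoly.algHom_ext_ring hy) (Sweedler.algHom_ext hg hx))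

/-- The automorphism `y ↦ c y`, `g ↦ g`, `x ↦ d x` of `k⟨y | y ^ p = 0⟩ ⊗ H₄`. -/
def tensorScaleEquiv (c : kˣ × kˣ) :
    TruncPoly k p ⊗[k] Sweedler k ≃ₐc[k] TruncPoly k p ⊗[k] Sweedler k :=
  BialgEquiv.ofBialgHom
    (Bialgebra.TensorProduct.map (TruncPoly.scale k p c.1) (Sweedler.scale k c.2))
    (Bialgebra.TensorProduct.map (TruncPoly.scale k p (c.1⁻¹ : kˣ)) (Sweedler.scale k (c.2⁻¹ : kˣ)))
    (tensorBialgHom_ext (by simp [smul_smul]) (by simp) (by simp [smul_smul]))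
    (tensorBialgHom_ext (by simp [smul_smul]) (by simp) (by simp [smul_smul]))

theorem tensorScaleEquiv_apply (c : kˣ × kˣ) (u : TruncPoly k p ⊗[k] Sweedler k) :
    tensorScaleEquiv k p c u =
      Bialgebra.TensorProduct.map (TruncPoly.scale k p c.1) (Sweedler.scale k c.2) u := rfl

-- The three images are constrained separately: 1 ⊗ g is the only nontrivial group-like element, y ⊗
-- 1 spans the primitive elements, and 1 ⊗ x is skew primitive and anticommutes with 1 ⊗ g.
variable {k p} in
theorem exists_scale_of_bialgEquiv (h2 : (2 : k) ≠ 0)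
    (e : TruncPoly k p ⊗[k] Sweedler k ≃ₐc[k] TruncPoly k p ⊗[k] Sweedler k) :
    e (1 ⊗ₜ[k] Sweedler.g k) = 1 ⊗ₜ[k] Sweedler.g k ∧
      (∃ c : k, e (TruncPoly.y k p ⊗ₜ[k] 1) = c • (TruncPoly.y k p ⊗ₜ[k] 1)) ∧
      ∃ d : k, e (1 ⊗ₜ[k] Sweedler.x k) = d • (1 ⊗ₜ[k] Sweedler.x k) := by
  have hg : e (1 ⊗ₜ[k] Sweedler.g k) = 1 ⊗ₜ[k] Sweedler.g k :=
    eq_one_tmul_g ((isGroupLikeElem_one_tmul_g k p).map e)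
      fun h => one_tmul_g_ne_one k p (EquivLike.injective e (h.trans (map_one e).symm))
  refine ⟨hg, ?_, ?_⟩
  · exact exists_eq_smul_y_tmul_one (by
      rw [← CoalgHomClass.map_comp_comul_apply e, comul_y_tmul_one, map_add,
        TensorProduct.map_tmul, TensorProduct.map_tmul]
      simp)
  · obtain ⟨a, d, h⟩ := exists_eq_one_tmul (u := e (1 ⊗ₜ[k] Sweedler.x k)) (by
      rw [← CoalgHomClass.map_comp_comul_apply e, comul_one_tmul_x, map_add,
        TensorProduct.map_tmul, TensorProduct.map_tmul]
      simp [hg])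
    rw [TensorProduct.tmul_add, TensorProduct.tmul_smul, TensorProduct.tmul_smul,
      TensorProduct.tmul_sub, ← Algebra.TensorProduct.one_def] at h
    have ha : a = 0 := by
      refine eq_zero_of_anticommute (c := d) h2 ?_ (one_tmul_x_mul_g k p)
        (one_tmul_g_ne_one k p) ?_
      · simp [Sweedler.g_mul_g, Algebra.TensorProduct.one_def]
      · have h' := congrArg e (one_tmul_x_mul_g k p)
        rwa [map_neg, map_mul, map_mul, hg, h] at h'
    exact ⟨d, by rw [h, ha, zero_smul, zero_add]⟩

/-- The automorphisms of `k⟨y | y ^ p = 0⟩ ⊗ H₄` are the scalings of `y` and `x`. -/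
def unitsProdEquivAut (h2 : (2 : k) ≠ 0) : kˣ × kˣ ≃*
    (TruncPoly k p ⊗[k] Sweedler k ≃ₐc[k] TruncPoly k p ⊗[k] Sweedler k) :=
  MulEquiv.ofBijective
    (MonoidHom.mk' (tensorScaleEquiv k p) (fun c d => BialgEquiv.ext fun b => by
      refine BialgHom.congr_fun (φ₁ := Bialgebra.TensorProduct.map _ _)
        (φ₂ := BialgHom.comp (Bialgebra.TensorProduct.map (TruncPoly.scale k p c.1)
          (Sweedler.scale k c.2)) (Bialgebra.TensorProduct.map (TruncPoly.scale k p d.1)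
          (Sweedler.scale k d.2))) (tensorBialgHom_ext ?_ ?_ ?_) b
      · simp [smul_smul, mul_comm]
      · simp
      · simp [smul_smul, mul_comm]))
    ⟨fun c d h => by
      have hy : tensorScaleEquiv k p c (TruncPoly.y k p ⊗ₜ[k] 1) =
        tensorScaleEquiv k p d (TruncPoly.y k p ⊗ₜ[k] 1) := DFunLike.congr_fun h _
      have hx : tensorScaleEquiv k p c (1 ⊗ₜ[k] Sweedler.x k) =
        tensorScaleEquiv k p d (1 ⊗ₜ[k] Sweedler.x k) := DFunLike.congr_fun h _
      simp only [tensorScaleEquiv_apply, Bialgebra.TensorProduct.map_tmul, TruncPoly.scale_y,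
        Sweedler.scale_x, map_one, TensorProduct.tmul_smul, ← TensorProduct.smul_tmul'] at hy hx
      exact Prod.ext (Units.ext (smul_left_injective k (y_tmul_one_ne_zero k p) hy))
        (Units.ext (smul_left_injective k (one_tmul_x_ne_zero k p) hx)),
    fun e => by
      obtain ⟨hg, ⟨c, hc⟩, d, hd⟩ := exists_scale_of_bialgEquiv h2 e
      have hc0 : c ≠ 0 := by
        rintro rfl
        rw [zero_smul] at hc
        exact y_tmul_one_ne_zero k p (EquivLike.injective e (hc.trans (map_zero e).symm))
      have hd0 : d ≠ 0 := by
        rintro rfl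
        rw [zero_smul] at hd
        exact one_tmul_x_ne_zero k p (EquivLike.injective e (hd.trans (map_zero e).symm))
      refine ⟨(Units.mk0 c hc0, Units.mk0 d hd0), BialgEquiv.ext fun b => ?_⟩
      refine BialgHom.congr_fun (φ₁ := Bialgebra.TensorProduct.map _ _)
        (φ₂ := (e : TruncPoly k p ⊗[k] Sweedler k →ₐc[k] TruncPoly k p ⊗[k] Sweedler k))
        (tensorBialgHom_ext ?_ ?_ ?_) b
      · simp [hc, TensorProduct.smul_tmul']
      · simp [hg]
      · simp [hd]⟩

end TensorAut

/-! ### The crossed systems -/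

section Classification

variable (k : Type*) [Field k] (p : ℕ)

theorem Sweedler.cocycle_zero : Sweedler.cocycle k p 0 =
    (Coalgebra.counit (R := k) (A := Sweedler k ⊗[k] Sweedler k)).smulRight
      (1 : TruncPoly k p) := by
  rw [cocycle, zero_smul]
  ext
  simp

variable [Fact p.Prime] [CharP k p]

/-- The axioms are transported, from A ⊗ H₄ if l = 0 and from A_{4p} otherwise; the second
comparison needs l⁻¹, hence the case split. -/
theorem isCrossedSystem_cocycle (l : k) :
    IsCrossedSystem (trivialAct k (TruncPoly k p) (Sweedler k)) (Sweedler.cocycle k p l) := by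
  rcases eq_or_ne l 0 with rfl | hl
  · refine isWeakAction_trivialAct.isCrossedSystem (CoalgEquiv.refl k _) rfl fun u v => ?_
    rw [Sweedler.cocycle_zero]
    exact crossedMul_trivial u v
  · exact isWeakAction_trivialAct.isCrossedSystem (FourP.tensorEquiv k p hl)
      (FourP.tensorHom_one k p _) (FourP.tensorHom_crossedMul k p hl)

/-- The crossed system with trivial action and `f(x, x) = l y`. -/
def cocycleSystem (l : k) : CrossedSystem k (TruncPoly k p) (Sweedler k) :=
  ⟨trivialAct k _ _, Sweedler.cocycle k p l, isCrossedSystem_cocycle k p l⟩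

variable {k p} in
theorem exists_eq_cocycleSystem (S : CrossedSystem k (TruncPoly k p) (Sweedler k)) :
    ∃ l : k, S = cocycleSystem k p l := by
  obtain ⟨l, hl⟩ := Sweedler.exists_eq_cocycle S.isCrossedSystem
  exact ⟨l, CrossedSystem.ext (Sweedler.act_eq_trivialAct S.isCrossedSystem) hl⟩

theorem cocycleSystem_injective : Function.Injective (cocycleSystem k p) := by
  intro l m h
  have h' : Sweedler.cocycle k p l = Sweedler.cocycle k p m := congrArg CrossedSystem.coc h
  have h1 := DFunLike.congr_fun h' (Sweedler.x k ⊗ₜ[k] Sweedler.x k)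
  rw [Sweedler.cocycle_tmul, Sweedler.cocycle_tmul, Sweedler.coord_x, Sweedler.coord_x] at h1
  exact smul_left_injective k (TruncPoly.y_ne_zero k p (Fact.out : p.Prime).one_lt)
    (by simpa using h1)

/-- The crossed product of the trivial crossed system is the tensor product. -/
def crossedProductZeroEquiv :
    CrossedProduct (cocycleSystem k p 0) ≃ₐc[k] TruncPoly k p ⊗[k] Sweedler k :=
  CrossedProduct.bialgEquiv _ (CoalgEquiv.refl k _) fun u v => by
    change crossedMul (trivialAct k _ _) (Sweedler.cocycle k p 0) (u ⊗ₜ[k] v) = u * v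
    rw [Sweedler.cocycle_zero]
    exact crossedMul_trivial u v

/-- The crossed products of the nontrivial crossed systems are `A_{4p}`. -/
def crossedProductEquivFourP {l : k} (hl : l ≠ 0) :
    CrossedProduct (cocycleSystem k p l) ≃ₐc[k] FourP k p :=
  CrossedProduct.bialgEquiv _ (FourP.tensorEquiv k p hl) (FourP.tensorHom_crossedMul k p hl)

/-- Classes in H² are therefore finer than isomorphism classes: each l is its own class, while all l
≠ 0 give A_{4p}. -/
theorem cohomologous_iff (X Y : CrossedSystem k (TruncPoly k p) (Sweedler k)) :
    Cohomologous X Y ↔ X = Y :=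
  cohomologous_iff_eq (Sweedler.cocentral_eq k) X Y

theorem equivalence_cohomologous :
    Equivalence (Cohomologous (k := k) (A := TruncPoly k p) (H := Sweedler k)) where
  refl X := (cohomologous_iff k p X X).2 rfl
  symm h := (cohomologous_iff k p _ _).2 ((cohomologous_iff k p _ _).1 h).symm
  trans h h' := (cohomologous_iff k p _ _).2
    (((cohomologous_iff k p _ _).1 h).trans ((cohomologous_iff k p _ _).1 h'))

theorem bijective_mk_cocycleSystem : Function.Bijective
    (fun l => (Quot.mk _ (cocycleSystem k p l) : CrossedH2 k (Sweedler k) (TruncPoly k p))) := by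
  refine ⟨fun l m h => cocycleSystem_injective k p ?_, fun c => ?_⟩
  · exact (cohomologous_iff k p _ _).1 (((equivalence_cohomologous k p).quot_mk_eq_iff _ _).1 h)
  · induction c using Quot.ind with
    | mk S =>
      obtain ⟨l, rfl⟩ := exists_eq_cocycleSystem S
      exact ⟨l, rfl⟩

end Classification

end

theorem mainTheorem11 (k : Type*) [Field k] (p : ℕ) [Fact p.Prime] [CharP k p] (hp : 3 ≤ p) :
    -- every crossed product of Hopf algebras `A # H₄` is `A ⊗ H₄` or `A_{4p}`
    (∀ S : CrossedSystem k (TruncPoly k p) (Sweedler k),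
      Nonempty (CrossedProduct S ≃ₐc[k] TruncPoly k p ⊗[k] Sweedler k) ∨
        Nonempty (CrossedProduct S ≃ₐc[k] FourP k p)) ∧
    -- both occur
    (∃ S : CrossedSystem k (TruncPoly k p) (Sweedler k),
      Nonempty (CrossedProduct S ≃ₐc[k] TruncPoly k p ⊗[k] Sweedler k)) ∧
    (∃ S : CrossedSystem k (TruncPoly k p) (Sweedler k),
      Nonempty (CrossedProduct S ≃ₐc[k] FourP k p)) ∧
    -- and they are not isomorphic
    IsEmpty (TruncPoly k p ⊗[k] Sweedler k ≃ₐc[k] FourP k p) ∧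
    Module.finrank k (FourP k p) = 4 * p ∧
    -- the groups of Hopf algebra automorphisms
    Nonempty ((TruncPoly k p ⊗[k] Sweedler k ≃ₐc[k] TruncPoly k p ⊗[k] Sweedler k) ≃*
      kˣ × kˣ) ∧
    Nonempty ((FourP k p ≃ₐc[k] FourP k p) ≃* kˣ) ∧
    -- being cohomologous is an equivalence relation, and its quotient `H²(H₄, A)` is `k`
    Equivalence (Cohomologous (k := k) (A := TruncPoly k p) (H := Sweedler k)) ∧
    Nonempty (CrossedH2 k (Sweedler k) (TruncPoly k p) ≃ k) := by
  have h2 := two_ne_zero_of_three_le k hp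
  refine ⟨fun S => ?_, ⟨_, ⟨crossedProductZeroEquiv k p⟩⟩,
    ⟨_, ⟨crossedProductEquivFourP k p one_ne_zero⟩⟩, isEmpty_bialgEquiv_fourP k p h2,
    FourP.finrank_eq k p, ⟨(unitsProdEquivAut k p h2).symm⟩, ⟨(FourP.unitsEquivAut k p h2).symm⟩,
    equivalence_cohomologous k p, ⟨(Equiv.ofBijective _ (bijective_mk_cocycleSystem k p)).symm⟩⟩
  obtain ⟨l, rfl⟩ := exists_eq_cocycleSystem S
  rcases eq_or_ne l 0 with rfl | hl
  · exact Or.inl ⟨crossedProductZeroEquiv k p⟩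
  · exact Or.inr ⟨crossedProductEquivFourP k p hl⟩
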